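/- Let $n\ge 1$ and $\nu,\mu\in\mathbb{R}$ with $\mu>0$. On $\mathbb{C}^n$ put $\langle z,w\rangle=\sum_{j} z_j\overline{w_j}$, $|z|^2=\langle z,z\rangle$, let $dm$ be Lebesgue measure, and let $$\Delta_{\nu,\mu}=4\sum_{j=1}^n\frac{\partial^2}{\partial z_j\partial\bar z_j}+2i\nu(E+\overline E+n)+2\mu(E-\overline E)-(\nu^2+\mu^2)|z|^2,\qquad E=\sum_{j} z_j\frac{\partial}{\partial z_j},\quad \overline E=\sum_{j}\bar z_j\frac{\partial}{\partial\bar z_j}.$$ For $l=0,1,2,\dots$ let $$A^2_l(\Delta_{\nu,\mu})=\{F\in L^2(\mathbb{C}^n,dm)\cap C^\infty(\mathbb{C}^n):\ \Delta_{\nu,\mu}F=-2\mu(2l+n)F\}.$$ Then there is an orthogonal projector $P_l$ of $L^2(\mathbb{C}^n,dm)$ onto $A^2_l(\Delta_{\nu,\mu})$, and its Schwartz kernel is the function $$P^{\nu,\mu}_l(z,w)=\Big(\frac{\mu}{\pi}\Big)^n\frac{(n-1+l)!}{(n-1)!\,l!}\;j^{\nu,\mu}(z,w)\;e^{-\frac{\mu}{2}|z-w|^2}\;{}_1F_1(-l;n;\mu|z-w|^2),$$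 where $$j^{\nu,\mu}(z,w)=\exp\Big(-\frac{i\nu}{2}(|z|^2-|w|^2)+\frac{\mu}{2}\big(\langle z,w\rangle-\overline{\langle z,w\rangle}\big)\Big),\qquad {}_1F_1(a;c;x)=\sum_{k\ge0}\frac{(a)_k}{(c)_k}\frac{x^k}{k!},$$ with $(a)_k=a(a+1)\cdots(a+k-1)$. That is, $P^{\nu,\mu}_l$ is locally integrable on $\mathbb{C}^n\times\mathbb{C}^n$ and $\int v\,P_lu\,dm=\iint P^{\nu,\mu}_l(z,w)\,v(z)\,u(w)\,dm(z)\,dm(w)$ for all $u,v\in C_c^\infty(\mathbb{C}^n)$; moreover, for every $f\in L^2(\mathbb{C}^n,dm)$ the function $w\mapsto P^{\nu,\mu}_l(z,w)f(w)$ is integrable for every $z$, and $P_lf(z)=\int P^{\nu,\mu}_l(z,w)f(w)\,dm(w)$ for almost every $z$. -/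

import Mathlib

open MeasureTheory
open scoped ContDiff Nat ComplexConjugate

noncomputable section

namespace TwistedLaplacian

/-- `ℂⁿ` with its Hermitian norm; as a real inner product space it carries Lebesgue measure
`dm = dx₁ dy₁ ⋯ dxₙ dyₙ` as `volume`. -/
abbrev Cn (n : ℕ) : Type := EuclideanSpace ℂ (Fin n)

/-- The Hilbert space `L²(ℂⁿ, dm)`. -/
abbrev L2 (n : ℕ) : Type := Lp ℂ 2 (volume : Measure (Cn n))

/-- The Hermitian form `⟨z, w⟩ = ∑ zⱼ w̄ⱼ`. -/
def herm {n : ℕ} (z w : Cn n) : ℂ := ∑ j, z j * conj (w j)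

/-- `∂F/∂zⱼ = (∂F/∂xⱼ - i ∂F/∂yⱼ) / 2`. -/
def dz {n : ℕ} (j : Fin n) (F : Cn n → ℂ) (z : Cn n) : ℂ :=
  (fderiv ℝ F z (EuclideanSpace.single j 1)
    - Complex.I * fderiv ℝ F z (EuclideanSpace.single j Complex.I)) / 2

/-- `∂F/∂z̄ⱼ = (∂F/∂xⱼ + i ∂F/∂yⱼ) / 2`. -/
def dzbar {n : ℕ} (j : Fin n) (F : Cn n → ℂ) (z : Cn n) : ℂ :=
  (fderiv ℝ F z (EuclideanSpace.single j 1)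
    + Complex.I * fderiv ℝ F z (EuclideanSpace.single j Complex.I)) / 2

/-- The complex Euler operator `E = ∑ zⱼ ∂/∂zⱼ`. -/
def euler {n : ℕ} (F : Cn n → ℂ) (z : Cn n) : ℂ := ∑ j, z j * dz j F z

/-- The conjugate Euler operator `Ē = ∑ z̄ⱼ ∂/∂z̄ⱼ`. -/
def eulerBar {n : ℕ} (F : Cn n → ℂ) (z : Cn n) : ℂ := ∑ j, conj (z j) * dzbar j F z

/-- The twisted Laplacian
`Δ_{ν,μ} = 4 ∑ ∂²/∂zⱼ∂z̄ⱼ + 2iν(E + Ē + n) + 2μ(E - Ē) - (ν² + μ²)|z|²`. -/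
def twistedLaplacian {n : ℕ} (ν μ : ℝ) (F : Cn n → ℂ) (z : Cn n) : ℂ :=
  4 * ∑ j, dz j (dzbar j F) z
    + 2 * Complex.I * ν * (euler F z + eulerBar F z + n * F z)
    + 2 * μ * (euler F z - eulerBar F z)
    - ((ν : ℂ) ^ 2 + (μ : ℂ) ^ 2) * (‖z‖ : ℂ) ^ 2 * F z

section linearity

variable {n : ℕ} {F G : Cn n → ℂ}

theorem dz_add (hF : ContDiff ℝ ∞ F) (hG : ContDiff ℝ ∞ G) (j : Fin n) :
    dz j (F + G) = dz j F + dz j G := by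
  funext z
  have h1 : DifferentiableAt ℝ F z := (hF.differentiable (by simp)) z
  have h2 : DifferentiableAt ℝ G z := (hG.differentiable (by simp)) z
  simp only [dz, fderiv_add h1 h2, Pi.add_apply, _root_.add_apply]
  ring

theorem dzbar_add (hF : ContDiff ℝ ∞ F) (hG : ContDiff ℝ ∞ G) (j : Fin n) :
    dzbar j (F + G) = dzbar j F + dzbar j G := by
  funext z
  have h1 : DifferentiableAt ℝ F z := (hF.differentiable (by simp)) z
  have h2 : DifferentiableAt ℝ G z := (hG.differentiable (by simp)) z
  simp only [dzbar, fderiv_add h1 h2, Pi.add_apply, _root_.add_apply]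
  ring

theorem dz_smul (hF : ContDiff ℝ ∞ F) (c : ℂ) (j : Fin n) : dz j (c • F) = c • dz j F := by
  funext z
  have h1 : DifferentiableAt ℝ F z := (hF.differentiable (by simp)) z
  simp only [dz, fderiv_const_smul h1, Pi.smul_apply, _root_.smul_apply, smul_eq_mul]
  ring

theorem dzbar_smul (hF : ContDiff ℝ ∞ F) (c : ℂ) (j : Fin n) :
    dzbar j (c • F) = c • dzbar j F := by
  funext z
  have h1 : DifferentiableAt ℝ F z := (hF.differentiable (by simp)) z
  simp only [dzbar, fderiv_const_smul h1, Pi.smul_apply, _root_.smul_apply,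
    smul_eq_mul]
  ring

theorem contDiff_dzbar (hF : ContDiff ℝ ∞ F) (j : Fin n) : ContDiff ℝ ∞ (dzbar j F) := by
  have h : ContDiff ℝ ∞ (fderiv ℝ F) := hF.fderiv_right (by simp)
  unfold dzbar
  fun_prop

theorem twistedLaplacian_add (ν μ : ℝ) (hF : ContDiff ℝ ∞ F) (hG : ContDiff ℝ ∞ G) :
    twistedLaplacian ν μ (F + G) = twistedLaplacian ν μ F + twistedLaplacian ν μ G := by
  funext z
  simp only [twistedLaplacian, euler, eulerBar, dzbar_add hF hG, dz_add hF hG,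
    dz_add (contDiff_dzbar hF _) (contDiff_dzbar hG _), Pi.add_apply, mul_add,
    Finset.sum_add_distrib]
  ring

theorem twistedLaplacian_smul (ν μ : ℝ) (c : ℂ) (hF : ContDiff ℝ ∞ F) :
    twistedLaplacian ν μ (c • F) = c • twistedLaplacian ν μ F := by
  funext z
  simp only [twistedLaplacian, euler, eulerBar, dzbar_smul hF, dz_smul hF,
    dz_smul (contDiff_dzbar hF _), Pi.smul_apply, smul_eq_mul, mul_left_comm _ c,
    ← Finset.mul_sum]
  ring

end linearity

/-- The eigenspace `E_lam(Δ_{ν,μ})` of `Δ_{ν,μ}` in `C^∞(ℂⁿ)` for the eigenvalue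
`-2μ(2 lam + n)`. -/
def smoothEigenspace (n : ℕ) (ν μ : ℝ) (lam : ℂ) : Submodule ℂ (Cn n → ℂ) where
  carrier := {F | ContDiff ℝ ∞ F ∧
    ∀ z, twistedLaplacian ν μ F z = -2 * μ * (2 * lam + n) * F z}
  add_mem' := by
    rintro F G ⟨hF, hF'⟩ ⟨hG, hG'⟩
    refine ⟨hF.add hG, fun z => ?_⟩
    rw [twistedLaplacian_add ν μ hF hG, Pi.add_apply, hF', hG', Pi.add_apply]
    ring
  zero_mem' := by
    refine ⟨contDiff_const, fun z => ?_⟩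
    have h := twistedLaplacian_smul (F := (0 : Cn n → ℂ)) ν μ 0 contDiff_const
    rw [zero_smul, zero_smul] at h
    simp [h]
  smul_mem' := by
    rintro c F ⟨hF, hF'⟩
    refine ⟨contDiff_const.smul hF, fun z => ?_⟩
    rw [twistedLaplacian_smul ν μ c hF, Pi.smul_apply, hF', Pi.smul_apply, smul_eq_mul,
      smul_eq_mul, mul_left_comm]

/-- The `L²`-eigenspace `A²_lam(Δ_{ν,μ}) = L²(ℂⁿ, dm) ∩ E_lam(Δ_{ν,μ})`: the classes in `L²` that
have a representative in `E_lam(Δ_{ν,μ})`. -/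
def l2Eigenspace (n : ℕ) (ν μ : ℝ) (lam : ℂ) : Submodule ℂ (L2 n) where
  carrier := {f | ∃ F ∈ smoothEigenspace n ν μ lam, f =ᵐ[volume] F}
  add_mem' := by
    rintro f g ⟨F, hF, hfF⟩ ⟨G, hG, hgG⟩
    exact ⟨F + G, add_mem hF hG, (Lp.coeFn_add f g).trans (hfF.add hgG)⟩
  zero_mem' := ⟨0, zero_mem _, Lp.coeFn_zero ℂ 2 volume⟩
  smul_mem' := by
    rintro c f ⟨F, hF, hfF⟩
    exact ⟨c • F, Submodule.smul_mem _ c hF, (Lp.coeFn_smul c f).trans (hfF.const_smul c)⟩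

/-- The confluent hypergeometric series `₁F₁(a; c; x) = ∑ (a)ₖ / (c)ₖ · xᵏ / k!`. -/
def confluentHypergeometric (a c x : ℂ) : ℂ :=
  ∑' k : ℕ, (ascPochhammer ℂ k).eval a / (ascPochhammer ℂ k).eval c * (x ^ k / (k ! : ℂ))

/-- The phase factor
`j^{ν,μ}(z, w) = exp(-(iν/2)(|z|² - |w|²) + (μ/2)(⟨z, w⟩ - conj ⟨z, w⟩))`. -/
def phaseFactor {n : ℕ} (ν μ : ℝ) (z w : Cn n) : ℂ :=
  Complex.exp (-(Complex.I * ν / 2) * ((‖z‖ : ℂ) ^ 2 - (‖w‖ : ℂ) ^ 2)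
    + (μ / 2 : ℂ) * (herm z w - conj (herm z w)))

/-- The locally integrable function `K` on `ℂⁿ × ℂⁿ` is the Schwartz kernel of the bounded
operator `T` on `L²(ℂⁿ, dm)`: for all test functions `u`, `v` in `C_c^∞(ℂⁿ)`,
`∫ v(z) (T u)(z) dm(z) = ∬ K(z, w) v(z) u(w) dm(z) dm(w)`. -/
def IsSchwartzKernel {n : ℕ} (T : L2 n →L[ℂ] L2 n) (K : Cn n → Cn n → ℂ) : Prop :=
  LocallyIntegrable (fun p : Cn n × Cn n => K p.1 p.2) (volume.prod volume) ∧
  ∀ (u v : Cn n → ℂ) (hu : ContDiff ℝ ∞ u) (huc : HasCompactSupport u),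
    ContDiff ℝ ∞ v → HasCompactSupport v →
    ∫ z, v z * T ((hu.continuous.memLp_of_hasCompactSupport huc).toLp u) z =
      ∫ p : Cn n × Cn n, K p.1 p.2 * (v p.1 * u p.2) ∂(volume.prod volume)

end TwistedLaplacian

end

/-! The operator with kernel `K` = `projKernel` is shown to map L² into the eigenspace and to
satisfy ⟨h, Pf⟩ = ⟨h, f⟩ for every h there. These two facts make it the orthogonal projection, with
no separate argument that the eigenspace is closed.

On a phase factor times p(|z-w|²), `twistedLaplacian` reduces to 4(xp'' + np') - μ²xp with x =
|z-w|². The substitution p(x) = e^{-μx/2}R(μx) turns the eigenvalue equation into Kummer's, so `K(·,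
w)` is an eigenfunction. Gaussian decay of `K` gives boundedness on L² and smoothness of Pf, and
Green's formula with Fubini transfers the eigenvalue equation to Pf (`projOp_mem_smoothEigenspace`).

The core is the reproducing formula for an L² eigenfunction F
(`integral_projKernel_mul_eigenfunction`). Fix z and let G(s) be the integral over w of F(w) j(z,w)
e^{-s|z-w|²}. Green's formula against this twisted Gaussian gives a first-order ODE
(`gaussMoment_equation`). At s = μ/2 + d it reads G'/G = l/d - (l+n)/(d+μ) wherever G is nonzero, so
G = C d^l/(d+μ)^{l+n}. Concentration of Gaussians as s → ∞ gives C = πⁿF(z). Comparison with the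
Taylor expansion at d = 0 shows that the moments of |z-w|² against F j e^{-μ|z-w|²/2} vanish below
order l and determines the l-th (`gaussMoment_eigenfunction_half`). Since `K` is such a Gaussian
times a polynomial of degree l in |z-w|², only the leading coefficient contributes, and its
normalization returns F(z). Finally `K` is Hermitian symmetric, so reproduction of eigenfunctions
becomes the inner-product identity (`inner_projLp`). -/

noncomputable section

namespace TwistedLaplacian

variable {n : ℕ}

/-! ### Wirtinger calculus. -/

section wirtinger

variable {F G : Cn n → ℂ} {z : Cn n}

theorem dz_mul (hF : DifferentiableAt ℝ F z) (hG : DifferentiableAt ℝ G z) (j : Fin n) :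
    dz j (fun z => F z * G z) z = dz j F z * G z + F z * dz j G z := by
  simp only [dz, fderiv_fun_mul hF hG, _root_.add_apply, _root_.smul_apply, smul_eq_mul]
  ring

theorem dzbar_mul (hF : DifferentiableAt ℝ F z) (hG : DifferentiableAt ℝ G z) (j : Fin n) :
    dzbar j (fun z => F z * G z) z = dzbar j F z * G z + F z * dzbar j G z := by
  simp only [dzbar, fderiv_fun_mul hF hG, _root_.add_apply, _root_.smul_apply, smul_eq_mul]
  ring

theorem dz_fun_add (hF : DifferentiableAt ℝ F z) (hG : DifferentiableAt ℝ G z) (j : Fin n) :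
    dz j (fun z => F z + G z) z = dz j F z + dz j G z := by
  simp only [dz, fderiv_fun_add hF hG, _root_.add_apply]
  ring

theorem dzbar_fun_add (hF : DifferentiableAt ℝ F z) (hG : DifferentiableAt ℝ G z) (j : Fin n) :
    dzbar j (fun z => F z + G z) z = dzbar j F z + dzbar j G z := by
  simp only [dzbar, fderiv_fun_add hF hG, _root_.add_apply]
  ring

theorem dz_eq_of_hasFDerivAt {L : Cn n →L[ℝ] ℂ} (h : HasFDerivAt F L z) (j : Fin n) :
    dz j F z = (L (EuclideanSpace.single j 1)
      - Complex.I * L (EuclideanSpace.single j Complex.I)) / 2 := by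
  rw [dz, h.fderiv]

theorem dzbar_eq_of_hasFDerivAt {L : Cn n →L[ℝ] ℂ} (h : HasFDerivAt F L z) (j : Fin n) :
    dzbar j F z = (L (EuclideanSpace.single j 1)
      + Complex.I * L (EuclideanSpace.single j Complex.I)) / 2 := by
  rw [dzbar, h.fderiv]

/-- The `j`-th coordinate as a real-linear functional. -/
def coordL (j : Fin n) : Cn n →L[ℝ] ℂ := (EuclideanSpace.proj (𝕜 := ℂ) j).restrictScalars ℝ

@[simp] theorem coordL_apply (j : Fin n) (z : Cn n) : coordL j z = z j := rfl

/-- The complex conjugate of the `j`-th coordinate as a real-linear functional. -/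
def conjCoordL (j : Fin n) : Cn n →L[ℝ] ℂ := Complex.conjCLE.toContinuousLinearMap ∘L coordL j

@[simp] theorem conjCoordL_apply (j : Fin n) (z : Cn n) : conjCoordL j z = conj (z j) := rfl

theorem hasFDerivAt_coord (j : Fin n) : HasFDerivAt (fun z : Cn n => z j) (coordL j) z :=
  (coordL j).hasFDerivAt

theorem hasFDerivAt_conj_coord (j : Fin n) :
    HasFDerivAt (fun z : Cn n => conj (z j)) (conjCoordL j) z :=
  (conjCoordL j).hasFDerivAt

@[fun_prop] theorem contDiff_coord (j : Fin n) : ContDiff ℝ ∞ (fun z : Cn n => z j) :=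
  (coordL j).contDiff

@[fun_prop] theorem contDiff_conj_coord (j : Fin n) :
    ContDiff ℝ ∞ (fun z : Cn n => conj (z j)) :=
  (conjCoordL j).contDiff

theorem dz_coord_self (j : Fin n) : dz j (fun z : Cn n => z j) z = 1 := by
  rw [dz_eq_of_hasFDerivAt (hasFDerivAt_coord j)]
  simp

theorem dzbar_conj_coord_self (j : Fin n) : dzbar j (fun z : Cn n => conj (z j)) z = 1 := by
  rw [dzbar_eq_of_hasFDerivAt (hasFDerivAt_conj_coord j)]
  simp

theorem dz_const (c : ℂ) (j : Fin n) : dz j (fun _ : Cn n => c) z = 0 := by simp [dz]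

theorem dzbar_const (c : ℂ) (j : Fin n) : dzbar j (fun _ : Cn n => c) z = 0 := by simp [dzbar]

theorem contDiff_dz (hF : ContDiff ℝ ∞ F) (j : Fin n) : ContDiff ℝ ∞ (dz j F) := by
  have h : ContDiff ℝ ∞ (fderiv ℝ F) := hF.fderiv_right (by simp)
  unfold dz
  fun_prop

/-- Symmetry of the second real derivative. Green's formula needs it because its divergence term
differentiates the test function in the opposite order. -/
theorem dz_dzbar_comm (hF : ContDiff ℝ ∞ F) (j : Fin n) :
    dz j (dzbar j F) z = dzbar j (dz j F) z := by
  have h : ContDiff ℝ ∞ (fderiv ℝ F) := hF.fderiv_right (by simp)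
  have hd : DifferentiableAt ℝ (fderiv ℝ F) z := h.differentiable (by simp) z
  have hs : ∀ v u : Cn n, fderiv ℝ (fun z => fderiv ℝ F z v) z u
      = fderiv ℝ (fderiv ℝ F) z u v := fun v u => by
    rw [fderiv_clm_apply hd (differentiableAt_const v)]; simp
  have hsymm := (hF.contDiffAt (x := z)).isSymmSndFDerivAt
    (by simpa using (WithTop.coe_le_coe.2 le_top :
      ((2 : ℕ∞) : WithTop ℕ∞) ≤ ((⊤ : ℕ∞) : WithTop ℕ∞)))
  have hv : ∀ v : Cn n, DifferentiableAt ℝ (fun z => fderiv ℝ F z v) z := fun v =>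
    hd.clm_apply (differentiableAt_const v)
  set e : Cn n := EuclideanSpace.single j 1
  set i : Cn n := EuclideanSpace.single j Complex.I
  have h1 : HasFDerivAt (dzbar j F) ((2⁻¹ : ℂ) • (fderiv ℝ (fun z => fderiv ℝ F z e) z
      + Complex.I • fderiv ℝ (fun z => fderiv ℝ F z i) z)) z := by
    have := ((hv e).hasFDerivAt.add ((hv i).hasFDerivAt.const_smul Complex.I)).const_smul (2⁻¹ : ℂ)
    refine this.congr_of_eventuallyEq (Filter.Eventually.of_forall fun z => ?_)
    simp only [dzbar, Pi.smul_apply, Pi.add_apply, smul_eq_mul]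
    ring
  have h2 : HasFDerivAt (dz j F) ((2⁻¹ : ℂ) • (fderiv ℝ (fun z => fderiv ℝ F z e) z
      - Complex.I • fderiv ℝ (fun z => fderiv ℝ F z i) z)) z := by
    have := ((hv e).hasFDerivAt.sub ((hv i).hasFDerivAt.const_smul Complex.I)).const_smul (2⁻¹ : ℂ)
    refine this.congr_of_eventuallyEq (Filter.Eventually.of_forall fun z => ?_)
    simp only [dz, Pi.smul_apply, Pi.sub_apply, smul_eq_mul]
    ring
  rw [dz_eq_of_hasFDerivAt h1, dzbar_eq_of_hasFDerivAt h2]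
  simp only [_root_.smul_apply, _root_.add_apply, _root_.sub_apply, smul_eq_mul, hs]
  rw [hsymm.eq i e]
  ring

end wirtinger

/-! ### The twisted Laplacian on phase factors times radial functions. -/

theorem norm_sq_eq_sum (z : Cn n) : (‖z‖ : ℂ) ^ 2 = ∑ j, z j * conj (z j) := by
  rw [← Complex.ofReal_pow, EuclideanSpace.norm_sq_eq]
  push_cast
  exact Finset.sum_congr rfl fun j _ => by rw [Complex.mul_conj']

/-- The operator is a sum of one-variable operators, the constant `n` supplying one unit per
coordinate; later identities are then checked coordinate by coordinate. -/
theorem twistedLaplacian_eq_sum (ν μ : ℝ) (F : Cn n → ℂ) (z : Cn n) :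
    twistedLaplacian ν μ F z = ∑ j, (4 * dz j (dzbar j F) z
      + 2 * Complex.I * ν * (z j * dz j F z + conj (z j) * dzbar j F z + F z)
      + 2 * μ * (z j * dz j F z - conj (z j) * dzbar j F z)
      - (ν ^ 2 + μ ^ 2) * (z j * conj (z j)) * F z) := by
  have hn : (n : ℂ) = ∑ _j : Fin n, (1 : ℂ) := by simp
  rw [twistedLaplacian, euler, eulerBar, norm_sq_eq_sum, hn]
  simp only [Finset.mul_sum, Finset.sum_mul, ← Finset.sum_add_distrib, ← Finset.sum_sub_distrib]
  exact Finset.sum_congr rfl fun j _ => by ring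

theorem hasFDerivAt_norm_sub_sq (w z : Cn n) :
    HasFDerivAt (fun z => ‖z - w‖ ^ 2) (2 • innerSL ℝ (z - w)) z := by
  have := ((hasFDerivAt_id (𝕜 := ℝ) z).sub_const w).norm_sq
  exact this

theorem hasFDerivAt_radial {p : ℝ → ℂ} (w z : Cn n) (hp : DifferentiableAt ℝ p (‖z - w‖ ^ 2)) :
    HasFDerivAt (fun z => p (‖z - w‖ ^ 2))
      ((2 • innerSL ℝ (z - w)).smulRight (deriv p (‖z - w‖ ^ 2))) z := by
  have := hp.hasDerivAt.hasFDerivAt.comp z (hasFDerivAt_norm_sub_sq w z)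
  refine this.congr_fderiv ?_
  ext v
  simp
  ring

theorem inner_single_left (z : Cn n) (j : Fin n) (a : ℂ) :
    inner ℝ z (EuclideanSpace.single j a) = (a * conj (z j)).re := by
  rw [PiLp.inner_apply, Finset.sum_eq_single j]
  · simp [Complex.inner]
  · intro k _ hk
    simp [hk]
  · simp

theorem dz_radial {p : ℝ → ℂ} (w z : Cn n) (hp : DifferentiableAt ℝ p (‖z - w‖ ^ 2))
    (j : Fin n) : dz j (fun z => p (‖z - w‖ ^ 2)) z
      = conj (z j - w j) * deriv p (‖z - w‖ ^ 2) := by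
  rw [dz_eq_of_hasFDerivAt (hasFDerivAt_radial w z hp)]
  simp only [ContinuousLinearMap.smulRight_apply, _root_.smul_apply, innerSL_apply_apply,
    inner_single_left]
  apply Complex.ext <;> simp <;> ring

theorem dzbar_radial {p : ℝ → ℂ} (w z : Cn n) (hp : DifferentiableAt ℝ p (‖z - w‖ ^ 2))
    (j : Fin n) : dzbar j (fun z => p (‖z - w‖ ^ 2)) z
      = (z j - w j) * deriv p (‖z - w‖ ^ 2) := by
  rw [dzbar_eq_of_hasFDerivAt (hasFDerivAt_radial w z hp)]
  simp only [ContinuousLinearMap.smulRight_apply, _root_.smul_apply, innerSL_apply_apply,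
    inner_single_left]
  apply Complex.ext <;> simp <;> ring

theorem hasFDerivAt_phaseFactor (ν μ : ℝ) (w z : Cn n) :
    HasFDerivAt (fun z => phaseFactor ν μ z w) (phaseFactor ν μ z w •
      (-(Complex.I * ν / 2) • Complex.ofRealCLM.comp (2 • innerSL ℝ z)
        + (μ / 2 : ℂ) • ((∑ j, conj (w j) • coordL j) - ∑ j, w j • conjCoordL j))) z := by
  have h1 : HasFDerivAt (fun z : Cn n => ((‖z‖ : ℂ) ^ 2 - (‖w‖ : ℂ) ^ 2))
      (Complex.ofRealCLM.comp (2 • innerSL ℝ z)) z := by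
    have := Complex.ofRealCLM.hasFDerivAt.comp z (hasStrictFDerivAt_norm_sq z).hasFDerivAt
    simpa [Function.comp_def] using this.sub_const ((‖w‖ : ℂ) ^ 2)
  have h2 : HasFDerivAt (fun z : Cn n => herm z w - conj (herm z w))
      ((∑ j, conj (w j) • coordL j) - ∑ j, w j • conjCoordL j) z := by
    have := ((∑ j, conj (w j) • coordL j) - ∑ j, w j • conjCoordL j : Cn n →L[ℝ] ℂ).hasFDerivAt
      (x := z)
    refine this.congr_of_eventuallyEq (Filter.Eventually.of_forall fun z => ?_)
    simp [herm, mul_comm]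
  exact ((h1.const_smul (-(Complex.I * ν / 2))).add (h2.const_smul (μ / 2 : ℂ))).cexp

theorem contDiff_norm_sub_sq (w : Cn n) : ContDiff ℝ ∞ (fun z : Cn n => ‖z - w‖ ^ 2) :=
  (contDiff_id.sub contDiff_const).norm_sq ℝ

theorem contDiff_phaseFactor (ν μ : ℝ) :
    ContDiff ℝ ∞ (fun q : Cn n × Cn n => phaseFactor ν μ q.1 q.2) := by
  have h0 : ContDiff ℝ ∞ (fun z : Cn n => (‖z‖ : ℂ) ^ 2) := by
    have := Complex.ofRealCLM.contDiff.comp (contDiff_norm_sq ℝ (E := Cn n) (n := ∞))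
    simpa [Function.comp_def] using this
  have h1 : ∀ j, ContDiff ℝ ∞ (fun q : Cn n × Cn n => q.1 j) := fun j =>
    (contDiff_coord j).comp contDiff_fst
  have h2 : ∀ j, ContDiff ℝ ∞ (fun q : Cn n × Cn n => conj (q.1 j)) := fun j =>
    (contDiff_conj_coord j).comp contDiff_fst
  have h3 : ∀ j, ContDiff ℝ ∞ (fun q : Cn n × Cn n => q.2 j) := fun j =>
    (contDiff_coord j).comp contDiff_snd
  have h4 : ∀ j, ContDiff ℝ ∞ (fun q : Cn n × Cn n => conj (q.2 j)) := fun j =>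
    (contDiff_conj_coord j).comp contDiff_snd
  have h5 : ContDiff ℝ ∞ (fun q : Cn n × Cn n => (‖q.1‖ : ℂ) ^ 2) := h0.comp contDiff_fst
  have h6 : ContDiff ℝ ∞ (fun q : Cn n × Cn n => (‖q.2‖ : ℂ) ^ 2) := h0.comp contDiff_snd
  have h7 : ContDiff ℝ ∞ (fun q : Cn n × Cn n => herm q.1 q.2) :=
    ContDiff.sum fun j _ => (h1 j).mul (h4 j)
  have h8 : ContDiff ℝ ∞ (fun q : Cn n × Cn n => conj (herm q.1 q.2)) :=
    Complex.conjCLE.contDiff.comp h7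
  exact ((contDiff_const.mul (h5.sub h6)).add (contDiff_const.mul (h7.sub h8))).cexp

theorem contDiff_phaseFactor_left (ν μ : ℝ) (w : Cn n) :
    ContDiff ℝ ∞ (fun z => phaseFactor ν μ z w) :=
  ContDiff.comp (g := fun q : Cn n × Cn n => phaseFactor ν μ q.1 q.2) (f := fun z => (z, w))
    (contDiff_phaseFactor ν μ) (contDiff_id.prodMk contDiff_const)

theorem dz_phaseFactor (ν μ : ℝ) (w z : Cn n) (j : Fin n) :
    dz j (fun z => phaseFactor ν μ z w) z
      = phaseFactor ν μ z w * (-(Complex.I * ν / 2) * conj (z j) + μ / 2 * conj (w j)) := by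
  rw [dz_eq_of_hasFDerivAt (hasFDerivAt_phaseFactor ν μ w z)]
  simp [inner_single_left, apply_ite]
  have hz : conj (z j) = (z j).re - (z j).im * Complex.I := by apply Complex.ext <;> simp
  linear_combination (-(phaseFactor ν μ z w * μ / 4) * (conj (w j) + w j)) * Complex.I_sq
    + (phaseFactor ν μ z w * Complex.I * ν / 2) * hz

theorem dzbar_phaseFactor (ν μ : ℝ) (w z : Cn n) (j : Fin n) :
    dzbar j (fun z => phaseFactor ν μ z w) z
      = phaseFactor ν μ z w * (-(Complex.I * ν / 2) * z j - μ / 2 * w j) := by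
  rw [dzbar_eq_of_hasFDerivAt (hasFDerivAt_phaseFactor ν μ w z)]
  simp [inner_single_left, apply_ite]
  have hz : z j = (z j).re + (z j).im * Complex.I := by apply Complex.ext <;> simp
  linear_combination (phaseFactor ν μ z w * μ / 4 * (conj (w j) + w j)) * Complex.I_sq
    + (phaseFactor ν μ z w * Complex.I * ν / 2) * hz

/-- The twisted Laplacian of a twisted translate of a radial function. -/
theorem twistedLaplacian_phaseFactor_mul_radial (ν μ : ℝ) {p : ℝ → ℂ} (hp : ContDiff ℝ ∞ p)
    (w z : Cn n) :
    twistedLaplacian ν μ (fun z => phaseFactor ν μ z w * p (‖z - w‖ ^ 2)) z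
      = phaseFactor ν μ z w * (4 * ((‖z - w‖ ^ 2 : ℝ) * deriv (deriv p) (‖z - w‖ ^ 2)
          + n * deriv p (‖z - w‖ ^ 2)) - μ ^ 2 * (‖z - w‖ ^ 2 : ℝ) * p (‖z - w‖ ^ 2)) := by
  have hp' : ContDiff ℝ ∞ (deriv p) := by
    have := (contDiff_succ_iff_deriv (n := ∞) (f := p) (𝕜 := ℝ)).1 (by simpa using hp)
    exact this.2.2
  have hpd : Differentiable ℝ p := hp.differentiable (by simp)
  have hpd' : Differentiable ℝ (deriv p) := hp'.differentiable (by simp)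
  have hφ : Differentiable ℝ (fun z => phaseFactor ν μ z w) :=
    (contDiff_phaseFactor_left ν μ w).differentiable (by simp)
  have hx : Differentiable ℝ (fun z : Cn n => ‖z - w‖ ^ 2) :=
    (contDiff_norm_sub_sq w).differentiable (by simp)
  have hP : Differentiable ℝ (fun z : Cn n => p (‖z - w‖ ^ 2)) := hpd.comp hx
  have hP' : Differentiable ℝ (fun z : Cn n => deriv p (‖z - w‖ ^ 2)) := hpd'.comp hx
  have hc : ∀ j, Differentiable ℝ (fun z : Cn n => z j) := fun j =>
    (contDiff_coord j).differentiable (by simp)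
  have hdz : ∀ j z, dz j (fun z => phaseFactor ν μ z w * p (‖z - w‖ ^ 2)) z
      = phaseFactor ν μ z w * ((-(Complex.I * ν / 2) * conj (z j) + μ / 2 * conj (w j))
        * p (‖z - w‖ ^ 2) + conj (z j - w j) * deriv p (‖z - w‖ ^ 2)) := fun j z => by
    rw [dz_mul (hφ z) (hP z), dz_phaseFactor, dz_radial w z (hpd _)]
    ring
  -- Differences are written as sums with a negative so that the product and sum rules apply
  -- syntactically in `hdd`.
  have hdzb : ∀ j, dzbar j (fun z => phaseFactor ν μ z w * p (‖z - w‖ ^ 2))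
      = fun z => phaseFactor ν μ z w * ((-(Complex.I * ν / 2) * z j + (-(μ / 2 * w j)))
        * p (‖z - w‖ ^ 2) + (z j + -w j) * deriv p (‖z - w‖ ^ 2)) := fun j => by
    funext z
    rw [dzbar_mul (hφ z) (hP z), dzbar_phaseFactor, dzbar_radial w z (hpd _)]
    ring
  have hdd : ∀ j, dz j (dzbar j (fun z => phaseFactor ν μ z w * p (‖z - w‖ ^ 2))) z
      = phaseFactor ν μ z w * (-(Complex.I * ν / 2) * conj (z j) + μ / 2 * conj (w j))
          * ((-(Complex.I * ν / 2) * z j - μ / 2 * w j) * p (‖z - w‖ ^ 2)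
            + (z j - w j) * deriv p (‖z - w‖ ^ 2))
        + phaseFactor ν μ z w * (-(Complex.I * ν / 2) * p (‖z - w‖ ^ 2)
          + (-(Complex.I * ν / 2) * z j - μ / 2 * w j)
            * (conj (z j - w j) * deriv p (‖z - w‖ ^ 2))
          + deriv p (‖z - w‖ ^ 2)
          + (z j - w j) * (conj (z j - w j) * deriv (deriv p) (‖z - w‖ ^ 2))) := fun j => by
    have c1 : Differentiable ℝ (fun z : Cn n => -(Complex.I * ν / 2) * z j) := (hc j).const_mul _
    have c2 : Differentiable ℝ (fun z : Cn n => -(Complex.I * ν / 2) * z j + (-(μ / 2 * w j))) :=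
      c1.add_const _
    have c3 : Differentiable ℝ (fun z : Cn n => z j + -w j) := (hc j).add_const _
    have c4 : Differentiable ℝ (fun z : Cn n => (-(Complex.I * ν / 2) * z j + (-(μ / 2 * w j)))
        * p (‖z - w‖ ^ 2)) := c2.mul hP
    have c5 : Differentiable ℝ (fun z : Cn n => (z j + -w j) * deriv p (‖z - w‖ ^ 2)) :=
      c3.mul hP'
    have c6 : Differentiable ℝ (fun z : Cn n => (-(Complex.I * ν / 2) * z j + (-(μ / 2 * w j)))
        * p (‖z - w‖ ^ 2) + (z j + -w j) * deriv p (‖z - w‖ ^ 2)) := c4.add c5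
    rw [hdzb j, dz_mul (hφ z) (c6 z), dz_phaseFactor, dz_fun_add (c4 z) (c5 z), dz_mul (c2 z) (hP z), dz_mul (c3 z) (hP' z),
      dz_fun_add (c1 z) (differentiableAt_const _), dz_fun_add (hc j z) (differentiableAt_const _),
      dz_mul (differentiableAt_const _) (hc j z), dz_const, dz_const, dz_const, dz_coord_self,
      dz_radial w z (hpd _), dz_radial w z (hpd' _)]
    ring
  have hn : (n : ℂ) = ∑ _j : Fin n, (1 : ℂ) := by simp
  have hxs : ((‖z - w‖ ^ 2 : ℝ) : ℂ) = ∑ j, (z j - w j) * conj (z j - w j) := by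
    rw [Complex.ofReal_pow, norm_sq_eq_sum]; rfl
  rw [twistedLaplacian_eq_sum, hxs, hn]
  simp only [hdd]
  simp only [hdz, hdzb, Finset.mul_sum, Finset.sum_mul, ← Finset.sum_add_distrib,
    ← Finset.sum_sub_distrib]
  refine Finset.sum_congr rfl fun j _ => ?_
  simp only [map_sub]
  -- All first-order terms in ν cancel; the ν² term cancels through i² = -1.
  linear_combination (-(phaseFactor ν μ z w * p (‖z - w‖ ^ 2)) * ν ^ 2 * z j * conj (z j))
    * Complex.I_sq

/-! ### Symmetries of the phase factor. -/

/-- Exchanging the arguments flips the signs of both parameters, exactly as transposing the operator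
does. Hence w ↦ j(z,w)p(|z-w|²) is adapted to the transposed operator. -/
theorem phaseFactor_swap (ν μ : ℝ) (z w : Cn n) :
    phaseFactor ν μ z w = phaseFactor (-ν) (-μ) w z := by
  have h : herm w z = conj (herm z w) := by simp [herm, mul_comm]
  rw [phaseFactor, phaseFactor, h, Complex.conj_conj]
  push_cast
  ring_nf

theorem conj_phaseFactor (ν μ : ℝ) (z w : Cn n) :
    conj (phaseFactor ν μ z w) = phaseFactor ν μ w z := by
  have h : herm w z = conj (herm z w) := by simp [herm, mul_comm]
  rw [phaseFactor, phaseFactor, h, ← Complex.exp_conj]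
  have h2 : conj (2 : ℂ) = 2 := map_ofNat _ 2
  simp [h2]
  ring_nf

theorem phaseFactor_self (ν μ : ℝ) (z : Cn n) : phaseFactor ν μ z z = 1 := by
  have h : conj (herm z z) = herm z z := by simp [herm, mul_comm]
  simp [phaseFactor, h]

theorem norm_phaseFactor (ν μ : ℝ) (z w : Cn n) : ‖phaseFactor ν μ z w‖ = 1 := by
  rw [phaseFactor, Complex.norm_exp]
  simp [← Complex.ofReal_pow]

/-! ### Integration by parts and Green's formula. -/

theorem integrable_of_continuous_mul {F u : Cn n → ℂ} (hF : Continuous F) (hu : Continuous u)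
    (hc : HasCompactSupport u) : Integrable (fun z => F z * u z) :=
  (hF.mul hu).integrable_of_hasCompactSupport hc.mul_left

theorem support_dz_subset (F : Cn n → ℂ) (j : Fin n) : Function.support (dz j F) ⊆ tsupport F := by
  intro z hz
  by_contra h
  have : fderiv ℝ F z = 0 := by
    by_contra h'
    exact h (support_fderiv_subset ℝ h')
  exact hz (by simp [dz, this])

theorem support_dzbar_subset (F : Cn n → ℂ) (j : Fin n) :
    Function.support (dzbar j F) ⊆ tsupport F := by
  intro z hz
  by_contra h
  have : fderiv ℝ F z = 0 := by
    by_contra h'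
    exact h (support_fderiv_subset ℝ h')
  exact hz (by simp [dzbar, this])

theorem hasCompactSupport_twistedLaplacian (ν μ : ℝ) {F : Cn n → ℂ} (hc : HasCompactSupport F) :
    HasCompactSupport (twistedLaplacian ν μ F) := by
  refine HasCompactSupport.intro hc fun z hz => ?_
  have h1 : ∀ j, dz j F z = 0 := fun j => by
    by_contra h; exact hz (support_dz_subset F j h)
  have h2 : ∀ j, dzbar j F z = 0 := fun j => by
    by_contra h; exact hz (support_dzbar_subset F j h)
  have h3 : ∀ j, dz j (dzbar j F) z = 0 := fun j => by
    by_contra h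
    exact hz (closure_minimal (support_dzbar_subset F j) (isClosed_tsupport F)
      (support_dz_subset _ j h))
  simp [twistedLaplacian, euler, eulerBar, h1, h2, h3, image_eq_zero_of_notMem_tsupport hz]

theorem integral_fderiv_of_hasCompactSupport {A : Cn n → ℂ} (hA : ContDiff ℝ ∞ A)
    (hc : HasCompactSupport A) (v : Cn n) : ∫ z, fderiv ℝ A z v = 0 := by
  have h := integral_mul_fderiv_eq_neg_fderiv_mul_of_integrable (μ := (volume : Measure (Cn n)))
    (f := fun _ => (1 : ℂ)) (g := A) (v := v) (by simp)
    (by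
      simp only [one_mul]
      exact ((hA.continuous_fderiv (by simp)).clm_apply continuous_const
        ).integrable_of_hasCompactSupport (hc.fderiv_apply ℝ v))
    (by simpa using hA.continuous.integrable_of_hasCompactSupport hc)
    (fun _ _ => differentiableAt_const _) (fun _ _ => hA.differentiable (by simp) _)
  simpa using h

theorem integrable_fderiv_of_hasCompactSupport {A : Cn n → ℂ} (hA : ContDiff ℝ ∞ A)
    (hc : HasCompactSupport A) (v : Cn n) : Integrable (fun z => fderiv ℝ A z v) :=
  ((hA.continuous_fderiv (by simp)).clm_apply continuous_const
    ).integrable_of_hasCompactSupport (hc.fderiv_apply ℝ v)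

theorem integral_dz_of_hasCompactSupport {A : Cn n → ℂ} (hA : ContDiff ℝ ∞ A)
    (hc : HasCompactSupport A) (j : Fin n) : Integrable (dz j A) ∧ ∫ z, dz j A z = 0 := by
  have i1 := integrable_fderiv_of_hasCompactSupport hA hc (EuclideanSpace.single j 1)
  have i2 := (integrable_fderiv_of_hasCompactSupport hA hc
    (EuclideanSpace.single j Complex.I)).const_mul Complex.I
  refine ⟨(i1.sub i2).div_const 2, ?_⟩
  simp only [dz]
  rw [integral_div, integral_sub i1 i2, integral_const_mul,
    integral_fderiv_of_hasCompactSupport hA hc, integral_fderiv_of_hasCompactSupport hA hc]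
  simp

theorem integral_dzbar_of_hasCompactSupport {A : Cn n → ℂ} (hA : ContDiff ℝ ∞ A)
    (hc : HasCompactSupport A) (j : Fin n) : Integrable (dzbar j A) ∧ ∫ z, dzbar j A z = 0 := by
  have i1 := integrable_fderiv_of_hasCompactSupport hA hc (EuclideanSpace.single j 1)
  have i2 := (integrable_fderiv_of_hasCompactSupport hA hc
    (EuclideanSpace.single j Complex.I)).const_mul Complex.I
  refine ⟨(i1.add i2).div_const 2, ?_⟩
  simp only [dzbar]
  rw [integral_div, integral_add i1 i2, integral_const_mul,
    integral_fderiv_of_hasCompactSupport hA hc, integral_fderiv_of_hasCompactSupport hA hc]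
  simp

theorem contDiff_twistedLaplacian (ν μ : ℝ) {F : Cn n → ℂ} (hF : ContDiff ℝ ∞ F) :
    ContDiff ℝ ∞ (twistedLaplacian ν μ F) := by
  have h0 : ContDiff ℝ ∞ (fun z : Cn n => (‖z‖ : ℂ) ^ 2) := by
    simp only [norm_sq_eq_sum]
    exact ContDiff.sum fun j _ => (contDiff_coord j).mul (contDiff_conj_coord j)
  have h1 : ContDiff ℝ ∞ (fun z : Cn n => ∑ j, dz j (dzbar j F) z) :=
    ContDiff.sum fun j _ => contDiff_dz (contDiff_dzbar hF j) j
  have h2 : ContDiff ℝ ∞ (euler F) :=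
    ContDiff.sum fun j _ => (contDiff_coord j).mul (contDiff_dz hF j)
  have h3 : ContDiff ℝ ∞ (eulerBar F) :=
    ContDiff.sum fun j _ => (contDiff_conj_coord j).mul (contDiff_dzbar hF j)
  unfold twistedLaplacian
  fun_prop

/-- Green's formula: the formal transpose of `Δ_{ν,μ}` is `Δ_{-ν,-μ}`. -/
theorem integral_twistedLaplacian_mul (ν μ : ℝ) {F u : Cn n → ℂ} (hF : ContDiff ℝ ∞ F)
    (hu : ContDiff ℝ ∞ u) (hc : HasCompactSupport u) :
    ∫ z, twistedLaplacian ν μ F z * u z = ∫ z, F z * twistedLaplacian (-ν) (-μ) u z := by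
  set α : ℂ := 2 * Complex.I * ν + 2 * μ with hα
  set β : ℂ := 2 * Complex.I * ν - 2 * μ with hβ
  -- The difference of the two integrands is the divergence ∑ (∂Aⱼ/∂zⱼ + ∂Bⱼ/∂z̄ⱼ); α and β are the
  -- coefficients of the two Euler operators.
  let A : Fin n → Cn n → ℂ := fun j z => (4 * dzbar j F z + α * z j * F z) * u z
  let B : Fin n → Cn n → ℂ := fun j z =>
    F z * (-4 * dz j u z + β * conj (z j) * u z)
  have a1 : ∀ j, ContDiff ℝ ∞ (fun z => 4 * dzbar j F z) := fun j =>
    contDiff_const.mul (contDiff_dzbar hF j)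
  have a2 : ∀ j, ContDiff ℝ ∞ (fun z : Cn n => α * z j) := fun j =>
    contDiff_const.mul (contDiff_coord j)
  have a3 : ∀ j, ContDiff ℝ ∞ (fun z => α * z j * F z) := fun j => (a2 j).mul hF
  have a4 : ∀ j, ContDiff ℝ ∞ (fun z => 4 * dzbar j F z + α * z j * F z) := fun j =>
    (a1 j).add (a3 j)
  have b1 : ∀ j, ContDiff ℝ ∞ (fun z => -4 * dz j u z) := fun j =>
    contDiff_const.mul (contDiff_dz hu j)
  have b2 : ∀ j, ContDiff ℝ ∞ (fun z : Cn n => β * conj (z j)) := fun j =>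
    contDiff_const.mul (contDiff_conj_coord j)
  have b3 : ∀ j, ContDiff ℝ ∞ (fun z => β * conj (z j) * u z) := fun j => (b2 j).mul hu
  have b4 : ∀ j, ContDiff ℝ ∞ (fun z => -4 * dz j u z + β * conj (z j) * u z) := fun j =>
    (b1 j).add (b3 j)
  have hA : ∀ j, ContDiff ℝ ∞ (A j) := fun j => (a4 j).mul hu
  have hB : ∀ j, ContDiff ℝ ∞ (B j) := fun j => hF.mul (b4 j)
  have hAc : ∀ j, HasCompactSupport (A j) := fun j => hc.mul_left
  have hdc : ∀ j, HasCompactSupport (dz j u) := fun j =>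
    HasCompactSupport.intro hc fun z hz => by
      by_contra h
      exact hz (support_dz_subset u j h)
  have hBc : ∀ j, HasCompactSupport (B j) := fun j =>
    (((hdc j).mul_left (f := fun _ => (-4 : ℂ))).add
      (hc.mul_left (f := fun z : Cn n => β * conj (z j)))).mul_left (f := F)
  have d : ∀ {f : Cn n → ℂ}, ContDiff ℝ ∞ f → ∀ z, DifferentiableAt ℝ f z := fun h z =>
    h.differentiable (by simp) z
  have key : ∀ z, twistedLaplacian ν μ F z * u z - F z * twistedLaplacian (-ν) (-μ) u z
      = ∑ j, (dz j (A j) z + dzbar j (B j) z) := fun z => by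
    have hA' : ∀ j, dz j (A j) z = (4 * dz j (dzbar j F) z + (α * F z + α * z j * dz j F z)) * u z
        + (4 * dzbar j F z + α * z j * F z) * dz j u z := fun j => by
      rw [dz_mul (d (a4 j) z) (d hu z), dz_fun_add (d (a1 j) z) (d (a3 j) z),
        dz_mul (differentiableAt_const _) (d (contDiff_dzbar hF j) z), dz_mul (d (a2 j) z) (d hF z),
        dz_mul (differentiableAt_const _) (d (contDiff_coord j) z), dz_const, dz_const,
        dz_coord_self]
      ring
    have hB' : ∀ j, dzbar j (B j) z = dzbar j F z * (-4 * dz j u z + β * conj (z j) * u z)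
        + F z * (-4 * dz j (dzbar j u) z + (β * u z + β * conj (z j) * dzbar j u z)) := fun j => by
      rw [dzbar_mul (d hF z) (d (b4 j) z), dzbar_fun_add (d (b1 j) z) (d (b3 j) z),
        dzbar_mul (differentiableAt_const _) (d (contDiff_dz hu j) z),
        dzbar_mul (d (b2 j) z) (d hu z),
        dzbar_mul (differentiableAt_const _) (d (contDiff_conj_coord j) z), dzbar_const,
        dzbar_const, dzbar_conj_coord_self, dz_dzbar_comm hu]
      ring
    simp only [hA', hB', twistedLaplacian_eq_sum, Finset.mul_sum, Finset.sum_mul,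
      ← Finset.sum_sub_distrib]
    refine Finset.sum_congr rfl fun j _ => ?_
    rw [hα, hβ]
    push_cast
    ring
  have hsum : ∫ z, ∑ j, (dz j (A j) z + dzbar j (B j) z) = 0 := by
    have hi : ∀ j, Integrable (fun z => dz j (A j) z + dzbar j (B j) z) := fun j =>
      (integral_dz_of_hasCompactSupport (hA j) (hAc j) j).1.add
        (integral_dzbar_of_hasCompactSupport (hB j) (hBc j) j).1
    rw [integral_finsetSum _ fun j _ => hi j]
    refine Finset.sum_eq_zero fun j _ => ?_
    rw [integral_add (integral_dz_of_hasCompactSupport (hA j) (hAc j) j).1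
      (integral_dzbar_of_hasCompactSupport (hB j) (hBc j) j).1,
      (integral_dz_of_hasCompactSupport (hA j) (hAc j) j).2,
      (integral_dzbar_of_hasCompactSupport (hB j) (hBc j) j).2, add_zero]
  have i1 : Integrable (fun z => twistedLaplacian ν μ F z * u z) :=
    integrable_of_continuous_mul (contDiff_twistedLaplacian ν μ hF).continuous hu.continuous hc
  have i2 : Integrable (fun z => F z * twistedLaplacian (-ν) (-μ) u z) :=
    integrable_of_continuous_mul hF.continuous (contDiff_twistedLaplacian _ _ hu).continuous
      (hasCompactSupport_twistedLaplacian _ _ hc)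
  rw [← sub_eq_zero, ← integral_sub i1 i2, ← hsum]
  exact integral_congr_ae (Filter.Eventually.of_forall key)

/-! ### The hypergeometric polynomial and the radial equation. -/

/-- The `k`-th coefficient of `₁F₁(-l; n; ·)`. -/
def hypCoeff (n l k : ℕ) : ℂ :=
  (ascPochhammer ℂ k).eval (-(l : ℂ)) / (ascPochhammer ℂ k).eval (n : ℂ) / (k ! : ℂ)

/-- The polynomial `₁F₁(-l; n; X)`. -/
def hypPoly (n l : ℕ) : Polynomial ℂ :=
  ∑ k ∈ Finset.range (l + 1), Polynomial.monomial k (hypCoeff n l k)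

theorem hypCoeff_of_lt {n l k : ℕ} (h : l < k) : hypCoeff n l k = 0 := by
  simp [hypCoeff, ascPochhammer_eval_neg_coe_nat_of_lt h]

theorem confluentHypergeometric_neg_nat (n l : ℕ) (x : ℂ) :
    confluentHypergeometric (-(l : ℂ)) n x = (hypPoly n l).eval x := by
  rw [confluentHypergeometric, tsum_eq_sum (s := Finset.range (l + 1)), hypPoly,
    Polynomial.eval_finsetSum]
  · refine Finset.sum_congr rfl fun k _ => ?_
    rw [Polynomial.eval_monomial, hypCoeff]
    ring
  · intro k hk
    rw [Finset.mem_range, not_lt] at hk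
    rw [ascPochhammer_eval_neg_coe_nat_of_lt (by omega)]
    simp

theorem coeff_hypPoly (n l k : ℕ) : (hypPoly n l).coeff k = hypCoeff n l k := by
  simp only [hypPoly, Polynomial.finsetSum_coeff, Polynomial.coeff_monomial]
  by_cases h : k ∈ Finset.range (l + 1)
  · rw [Finset.sum_eq_single_of_mem k h fun b _ hb => by simp [hb]]
    simp
  · rw [Finset.sum_eq_zero fun b hb => if_neg (by rintro rfl; exact h hb)]
    rw [Finset.mem_range, not_lt] at h
    rw [hypCoeff_of_lt (by omega)]

/-- This recursion is Kummer's equation read off coefficientwise; `1 ≤ n` keeps the denominators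
(n)ₖ nonzero. -/
theorem hypCoeff_succ {n : ℕ} (hn : 1 ≤ n) (l k : ℕ) :
    ((k : ℂ) + 1) * (n + k) * hypCoeff n l (k + 1) = (k - l) * hypCoeff n l k := by
  have h0 : (ascPochhammer ℂ k).eval (n : ℂ) ≠ 0 := by
    rw [← ascPochhammer_eval_cast]
    exact_mod_cast (ascPochhammer_pos k n hn).ne'
  have h1 : (n : ℂ) + k ≠ 0 := by exact_mod_cast (by omega : n + k ≠ 0)
  have h2 : (k : ℂ) + 1 ≠ 0 := by exact_mod_cast (by omega : k + 1 ≠ 0)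
  have h3 : (k ! : ℂ) ≠ 0 := by exact_mod_cast k.factorial_ne_zero
  rw [hypCoeff, hypCoeff, ascPochhammer_succ_eval, ascPochhammer_succ_eval, Nat.factorial_succ]
  push_cast
  field_simp
  ring

/-- Kummer's equation. -/
theorem hypPoly_kummer {n : ℕ} (hn : 1 ≤ n) (l : ℕ) (y : ℂ) :
    y * (hypPoly n l).derivative.derivative.eval y + (n - y) * (hypPoly n l).derivative.eval y
      + l * (hypPoly n l).eval y = 0 := by
  have h : Polynomial.X * (hypPoly n l).derivative.derivative
      + Polynomial.C (n : ℂ) * (hypPoly n l).derivative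
      - Polynomial.X * (hypPoly n l).derivative + Polynomial.C (l : ℂ) * hypPoly n l = 0 := by
    ext k
    have hk := hypCoeff_succ hn l k
    cases k with
    | zero =>
      simp only [Polynomial.coeff_add, Polynomial.coeff_sub, Polynomial.coeff_C_mul,
        Polynomial.coeff_X_mul_zero, Polynomial.coeff_derivative,
        coeff_hypPoly, Polynomial.coeff_zero] at hk ⊢
      push_cast at hk ⊢
      linear_combination hk
    | succ k =>
      simp only [Polynomial.coeff_add, Polynomial.coeff_sub, Polynomial.coeff_C_mul,
        Polynomial.coeff_X_mul, Polynomial.coeff_derivative,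
        coeff_hypPoly, Polynomial.coeff_zero] at hk ⊢
      push_cast at hk ⊢
      linear_combination hk
  have h' := congrArg (Polynomial.eval y) h
  simp only [Polynomial.eval_add, Polynomial.eval_sub, Polynomial.eval_mul, Polynomial.eval_X,
    Polynomial.eval_C, Polynomial.eval_zero] at h'
  linear_combination h'

/-- The function `e^{-μx/2} R(μx)` for a polynomial `R`. -/
def expPoly (μ : ℝ) (R : Polynomial ℂ) (x : ℝ) : ℂ :=
  Complex.exp (-(μ / 2) * x) * R.eval ((μ : ℂ) * x)

theorem hasDerivAt_expPoly (μ : ℝ) (R : Polynomial ℂ) (x : ℝ) :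
    HasDerivAt (expPoly μ R)
      (expPoly μ (Polynomial.C (μ : ℂ) * R.derivative - Polynomial.C (μ / 2 : ℂ) * R) x) x := by
  have h0 : HasDerivAt (fun x : ℝ => (x : ℂ)) 1 x := Complex.ofRealCLM.hasDerivAt
  have h1 := (h0.const_mul (-(μ / 2 : ℂ))).cexp
  have h2 := (R.hasDerivAt ((μ : ℂ) * x)).comp x (h0.const_mul (μ : ℂ))
  refine (h1.mul h2).congr_deriv ?_
  simp [expPoly]
  ring

theorem deriv_expPoly (μ : ℝ) (R : Polynomial ℂ) :
    deriv (expPoly μ R) = expPoly μ (Polynomial.C (μ : ℂ) * R.derivative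
      - Polynomial.C (μ / 2 : ℂ) * R) :=
  funext fun x => (hasDerivAt_expPoly μ R x).deriv

theorem contDiff_expPoly (μ : ℝ) (R : Polynomial ℂ) : ContDiff ℝ ∞ (expPoly μ R) := by
  have h0 : ContDiff ℝ ∞ (fun x : ℝ => (x : ℂ)) := Complex.ofRealCLM.contDiff
  have h1 : ContDiff ℝ ∞ (fun y : ℂ => R.eval y) := by
    have h := (R.contDiff_aeval (𝕜 := ℂ) ∞).restrict_scalars ℝ
    simpa using h
  exact ((contDiff_const.mul h0).cexp).mul (h1.comp (contDiff_const.mul h0))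

/-- With y = μx, the difference of the two sides is 4μe^{-μx/2} times Kummer's expression in y for a
= -l, c = n. -/
theorem expPoly_hypPoly_radial_equation {n : ℕ} (hn : 1 ≤ n) (l : ℕ) (μ x : ℝ) :
    4 * ((x : ℂ) * deriv (deriv (expPoly μ (hypPoly n l))) x
        + n * deriv (expPoly μ (hypPoly n l)) x) - μ ^ 2 * x * expPoly μ (hypPoly n l) x
      = -2 * μ * (2 * l + n) * expPoly μ (hypPoly n l) x := by
  have h := hypPoly_kummer hn l ((μ : ℂ) * x)
  rw [deriv_expPoly, deriv_expPoly]
  simp only [expPoly, Polynomial.derivative_sub, Polynomial.derivative_C_mul, Polynomial.eval_sub,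
    Polynomial.eval_mul, Polynomial.eval_C]
  linear_combination (4 * μ * Complex.exp (-(μ / 2) * x)) * h

/-! ### Gaussian estimates. -/

theorem pow_mul_exp_neg_le (k : ℕ) {b : ℝ} (hb : 0 < b) {x : ℝ} (hx : 0 ≤ x) :
    x ^ k * Real.exp (-b * x) ≤ (k ! / b ^ k) := by
  have h := Real.pow_div_factorial_le_exp (b * x) (by positivity) k
  have hk : (0 : ℝ) < k ! := by exact_mod_cast k.factorial_pos
  rw [neg_mul, Real.exp_neg, ← div_eq_mul_inv, div_le_div_iff₀ (Real.exp_pos _) (by positivity)]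
  rw [div_le_iff₀ hk, mul_pow] at h
  linarith

/-- Half of the decay e^{-μx/2} absorbs the polynomial; the other half is the stated e^{-μx/4}. -/
theorem exists_norm_expPoly_le {μ : ℝ} (hμ : 0 < μ) (R : Polynomial ℂ) :
    ∃ C, 0 ≤ C ∧ ∀ x : ℝ, 0 ≤ x → ‖expPoly μ R x‖ ≤ C * Real.exp (-(μ / 4) * x) := by
  refine ⟨∑ k ∈ Finset.range (R.natDegree + 1), ‖R.coeff k‖ * μ ^ k * (k ! / (μ / 4) ^ k),
    Finset.sum_nonneg fun k _ => by positivity, fun x hx => ?_⟩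
  have he : ‖Complex.exp (-(μ / 2 : ℂ) * x)‖
      = Real.exp (-(μ / 4) * x) * Real.exp (-(μ / 4) * x) := by
    rw [Complex.norm_exp, ← Real.exp_add]
    congr 1
    simp
    ring
  rw [expPoly, norm_mul, he, Polynomial.eval_eq_sum_range, mul_comm, ← mul_assoc]
  gcongr
  calc _ ≤ (∑ k ∈ Finset.range (R.natDegree + 1), ‖R.coeff k * ((μ : ℂ) * x) ^ k‖)
        * Real.exp (-(μ / 4) * x) := by gcongr; exact norm_sum_le _ _
    _ ≤ _ := by
      rw [Finset.sum_mul]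
      refine Finset.sum_le_sum fun k _ => ?_
      have := pow_mul_exp_neg_le k (b := μ / 4) (by positivity) hx
      rw [norm_mul, norm_pow, norm_mul, Complex.norm_real, Complex.norm_real, Real.norm_of_nonneg hx,
        Real.norm_of_nonneg hμ.le, mul_pow, ← mul_assoc, mul_assoc]
      gcongr

theorem integrable_gaussian {b : ℝ} (hb : 0 < b) :
    Integrable (fun w : Cn n => Real.exp (-b * ‖w‖ ^ 2)) := by
  have h := (GaussianFourier.integrable_cexp_neg_mul_sq_norm_add (V := Cn n) (b := (b : ℂ))
    (by simpa using hb) 0 0).norm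
  refine h.congr (Filter.Eventually.of_forall fun w => ?_)
  simp [Complex.norm_exp, ← Complex.ofReal_pow]

theorem integrable_gaussian_sub {b : ℝ} (hb : 0 < b) (z : Cn n) :
    Integrable (fun w : Cn n => Real.exp (-b * ‖z - w‖ ^ 2)) :=
  (integrable_gaussian hb).comp_sub_left z

theorem memLp_two_gaussian_sub {b : ℝ} (hb : 0 < b) (z : Cn n) :
    MemLp (fun w : Cn n => Real.exp (-b * ‖z - w‖ ^ 2)) 2 := by
  have hc : Continuous (fun w : Cn n => Real.exp (-b * ‖z - w‖ ^ 2)) := by fun_prop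
  rw [memLp_two_iff_integrable_sq hc.aestronglyMeasurable]
  refine (integrable_gaussian_sub (b := 2 * b) (by positivity) z).congr
    (Filter.Eventually.of_forall fun w => ?_)
  simp only [← Real.exp_nat_mul]
  ring_nf

theorem integrable_mul_gaussian_sub {f : Cn n → ℂ} (hf : MemLp f 2) {b : ℝ} (hb : 0 < b)
    (z : Cn n) : Integrable (fun w => ‖f w‖ * Real.exp (-b * ‖z - w‖ ^ 2)) :=
  hf.norm.integrable_mul (memLp_two_gaussian_sub hb z)

theorem norm_sub_sq_comm (z w : Cn n) : ‖z - w‖ ^ 2 = ‖w - z‖ ^ 2 := by rw [norm_sub_rev]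

theorem integrable_mul_of_norm_le_gaussian {f : Cn n → ℂ} (hf : MemLp f 2) {q : Cn n → ℂ}
    (hq : AEStronglyMeasurable q) {C b : ℝ} (hb : 0 < b) (z : Cn n)
    (h : ∀ w, ‖q w‖ ≤ C * Real.exp (-b * ‖z - w‖ ^ 2)) : Integrable (fun w => f w * q w) := by
  refine ((integrable_mul_gaussian_sub hf hb z).const_mul C).mono'
    (hf.aestronglyMeasurable.mul hq) (Filter.Eventually.of_forall fun w => ?_)
  rw [norm_mul]
  calc _ ≤ ‖f w‖ * (C * Real.exp (-b * ‖z - w‖ ^ 2)) := by gcongr; exact h w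
    _ = _ := by ring

theorem continuous_phaseFactor_right (ν μ : ℝ) (z : Cn n) :
    Continuous (fun w => phaseFactor ν μ z w) :=
  Continuous.comp (g := fun q : Cn n × Cn n => phaseFactor ν μ q.1 q.2) (f := fun w => (z, w))
    (contDiff_phaseFactor ν μ).continuous (continuous_const.prodMk continuous_id)

theorem memLp_mul_phaseFactor (ν μ : ℝ) {f : Cn n → ℂ} (hf : MemLp f 2) (z : Cn n) :
    MemLp (fun w => f w * phaseFactor ν μ z w) 2 := by
  refine hf.congr_norm (hf.aestronglyMeasurable.mul
    (continuous_phaseFactor_right ν μ z).aestronglyMeasurable)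
    (Filter.Eventually.of_forall fun w => ?_)
  rw [norm_mul, norm_phaseFactor, mul_one]

/-! ### Testing eigenfunctions against radial functions, and cutoffs. -/

/-- Pairing a smooth eigenfunction with a compactly supported twisted-radial test function. -/
theorem integral_eigenfunction_mul_radial {ν μ : ℝ} {lam : ℂ} {F : Cn n → ℂ}
    (hF : F ∈ smoothEigenspace n ν μ lam) (z : Cn n) {p : ℝ → ℂ} (hp : ContDiff ℝ ∞ p)
    {R : ℝ} (hR : ∀ x, R ≤ x → p x = 0) :
    -2 * μ * (2 * lam + n) * ∫ w, (F w * phaseFactor ν μ z w) * p (‖z - w‖ ^ 2)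
      = ∫ w, (F w * phaseFactor ν μ z w) * (4 * ((‖z - w‖ ^ 2 : ℝ) * deriv (deriv p) (‖z - w‖ ^ 2)
          + n * deriv p (‖z - w‖ ^ 2)) - μ ^ 2 * (‖z - w‖ ^ 2 : ℝ) * p (‖z - w‖ ^ 2)) := by
  set u : Cn n → ℂ := fun w => phaseFactor (-ν) (-μ) w z * p (‖w - z‖ ^ 2) with hu
  have hud : ContDiff ℝ ∞ u :=
    (contDiff_phaseFactor_left _ _ z).mul (hp.comp (contDiff_norm_sub_sq z))
  have huc : HasCompactSupport u := by
    refine HasCompactSupport.intro (isCompact_closedBall z (|R| + 1)) fun w hw => ?_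
    rw [Metric.mem_closedBall, not_le, dist_eq_norm] at hw
    have : R ≤ ‖w - z‖ ^ 2 := by nlinarith [abs_nonneg R, le_abs_self R]
    simp [hu, hR _ this]
  have h := integral_twistedLaplacian_mul ν μ hF.1 hud huc
  simp only [hF.2] at h
  rw [← integral_const_mul]
  refine Eq.trans (integral_congr_ae (Filter.Eventually.of_forall fun w => ?_))
    (h.trans (integral_congr_ae (Filter.Eventually.of_forall fun w => ?_)))
  · simp only
    rw [hu, phaseFactor_swap ν μ z w, norm_sub_sq_comm z w]
    ring
  · simp only
    rw [hu, twistedLaplacian_phaseFactor_mul_radial _ _ hp, phaseFactor_swap ν μ z w,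
      norm_sub_sq_comm z w]
    push_cast
    ring

/-- The result has the same shape, so a second application yields the second derivative. -/
theorem deriv_exp_mul (s : ℝ) {a : ℝ → ℝ} (ha : ContDiff ℝ ∞ a) :
    deriv (fun x : ℝ => Complex.exp (-s * x) * a x)
      = fun x : ℝ => Complex.exp (-s * x) * ((-s * a x + deriv a x : ℝ) : ℂ) := by
  funext x
  have h0 : HasDerivAt (fun x : ℝ => (x : ℂ)) 1 x := Complex.ofRealCLM.hasDerivAt
  have h1 := (h0.const_mul (-(s : ℂ))).cexp
  have h2 := ((ha.differentiable (by simp)) x).hasDerivAt.ofReal_comp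
  refine (h1.mul h2).deriv.trans ?_
  push_cast
  ring

theorem contDiff_deriv {a : ℝ → ℝ} (ha : ContDiff ℝ ∞ a) : ContDiff ℝ ∞ (deriv a) :=
  ((contDiff_succ_iff_deriv (n := ∞) (f := a) (𝕜 := ℝ)).1 (by simpa using ha)).2.2

/-- Smooth cutoffs with uniformly bounded first and second derivatives. -/
theorem exists_smooth_cutoff : ∃ (χ : ℕ → ℝ → ℝ) (B : ℝ), 0 ≤ B ∧ (∀ N, ContDiff ℝ ∞ (χ N)) ∧
    (∀ (N : ℕ) x, 2 * ((N : ℝ) + 1) ≤ x → χ N x = 0) ∧ (∀ N x, |χ N x| ≤ 1) ∧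
    (∀ N x, |deriv (χ N) x| ≤ B) ∧ (∀ N x, |deriv (deriv (χ N)) x| ≤ B) ∧
    ∀ x, ∀ᶠ N in Filter.atTop, χ N x = 1 ∧ deriv (χ N) x = 0 ∧ deriv (deriv (χ N)) x = 0 := by
  have hs : ContDiff ℝ ∞ (fun x : ℝ => Real.smoothTransition (2 - x)) :=
    Real.smoothTransition.contDiff.comp (contDiff_const.sub contDiff_id)
  -- A one-sided cutoff suffices, since it is only composed with |z-w|² ≥ 0.
  set θ : ℝ → ℝ := fun x => Real.smoothTransition (2 - x) with hθ
  have h1 : ∀ x, x ≤ 1 → θ x = 1 := fun x hx => Real.smoothTransition.one_of_one_le (by linarith)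
  have h2 : ∀ x, 2 ≤ x → θ x = 0 := fun x hx => Real.smoothTransition.zero_of_nonpos (by linarith)
  have e1 : ∀ x, x < 1 → θ =ᶠ[nhds x] fun _ => 1 := fun x hx =>
    (eventually_lt_nhds hx).mono fun y hy => h1 y hy.le
  have e2 : ∀ x, 2 < x → θ =ᶠ[nhds x] fun _ => 0 := fun x hx =>
    (eventually_gt_nhds hx).mono fun y hy => h2 y hy.le
  have bdd : ∀ f : ℝ → ℝ, Continuous f → (∀ x, x < 1 → f x = 0) → (∀ x, 2 < x → f x = 0) →
      ∃ B, 0 ≤ B ∧ ∀ x, |f x| ≤ B := fun f hf h0 h2 => by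
    obtain ⟨B, hB⟩ := (isCompact_Icc (a := (1 : ℝ)) (b := 2)).exists_bound_of_continuousOn
      hf.continuousOn
    refine ⟨max B 0, le_max_right _ _, fun x => ?_⟩
    by_cases hx : x ∈ Set.Icc (1 : ℝ) 2
    · exact (hB x hx).trans (le_max_left _ _)
    · rw [Set.mem_Icc, not_and_or, not_le, not_le] at hx
      rcases hx with hx | hx
      · simp [h0 x hx]
      · simp [h2 x hx]
  have hd := contDiff_deriv hs
  have hdd := contDiff_deriv hd
  obtain ⟨B₁, hB₁0, hB₁⟩ := bdd (deriv θ) hd.continuous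
    (fun x hx => by rw [(e1 x hx).deriv_eq]; simp) (fun x hx => by rw [(e2 x hx).deriv_eq]; simp)
  obtain ⟨B₂, hB₂0, hB₂⟩ := bdd (deriv (deriv θ)) hdd.continuous
    (fun x hx => by rw [(e1 x hx).deriv.deriv_eq]; simp)
    (fun x hx => by rw [(e2 x hx).deriv.deriv_eq]; simp)
  have hN : ∀ N : ℕ, (0 : ℝ) < (N : ℝ) + 1 := fun N => by positivity
  have hN' : ∀ N : ℕ, ((N : ℝ) + 1)⁻¹ ≤ 1 := fun N => inv_le_one_of_one_le₀ (by simp)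
  have d1 : ∀ (N : ℕ), deriv (fun x => θ (((N : ℝ) + 1)⁻¹ * x))
      = fun x => ((N : ℝ) + 1)⁻¹ * deriv θ (((N : ℝ) + 1)⁻¹ * x) := fun N => by
    funext x
    rw [deriv_comp_mul_left, smul_eq_mul]
  have d2 : ∀ (N : ℕ), deriv (deriv (fun x => θ (((N : ℝ) + 1)⁻¹ * x)))
      = fun x => ((N : ℝ) + 1)⁻¹ * (((N : ℝ) + 1)⁻¹
        * deriv (deriv θ) (((N : ℝ) + 1)⁻¹ * x)) := fun N => by
    funext x
    rw [d1, deriv_const_mul_field, deriv_comp_mul_left, smul_eq_mul]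
  -- Dilation by 1/(N+1) ≤ 1 can only shrink derivatives, so the bounds for θ are uniform in N.
  refine ⟨fun N x => θ (((N : ℝ) + 1)⁻¹ * x), max B₁ B₂, le_max_of_le_left hB₁0,
    fun N => hs.comp (contDiff_const.mul contDiff_id), fun N x hx => ?_, fun N x => ?_,
    fun N x => ?_, fun N x => ?_, fun x => ?_⟩
  · refine h2 _ ?_
    rw [inv_mul_eq_div, le_div_iff₀ (hN N)]
    exact hx
  · rw [abs_of_nonneg (Real.smoothTransition.nonneg _)]
    exact Real.smoothTransition.le_one _
  · rw [d1, abs_mul, abs_of_pos (inv_pos.2 (hN N))]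
    calc _ ≤ 1 * B₁ := mul_le_mul (hN' N) (hB₁ _) (abs_nonneg _) zero_le_one
      _ ≤ _ := by simp
  · rw [d2, abs_mul, abs_mul, abs_of_pos (inv_pos.2 (hN N))]
    calc _ ≤ 1 * (1 * B₂) := by
          have := hN' N
          have := hB₂ (((N : ℝ) + 1)⁻¹ * x)
          have := inv_pos.2 (hN N)
          gcongr
      _ ≤ _ := by simp
  · filter_upwards [Filter.eventually_ge_atTop ⌈x⌉₊] with N hx
    have hlt : ((N : ℝ) + 1)⁻¹ * x < 1 := by
      rw [inv_mul_eq_div, div_lt_one (hN N)]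
      have := Nat.le_ceil x
      have : ((⌈x⌉₊ : ℕ) : ℝ) ≤ N := by exact_mod_cast hx
      linarith
    refine ⟨h1 _ hlt.le, ?_, ?_⟩
    · rw [d1]; simp [(e1 _ hlt).deriv_eq]
    · rw [d2]; simp [(e1 _ hlt).deriv.deriv_eq]

theorem continuous_cexp_neg_mul_norm_sub_sq (s : ℝ) (z : Cn n) :
    Continuous (fun w : Cn n => Complex.exp (-s * (‖z - w‖ ^ 2 : ℝ))) := by fun_prop

theorem norm_cexp_neg_mul (s x : ℝ) : ‖Complex.exp (-s * x)‖ = Real.exp (-s * x) := by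
  rw [Complex.norm_exp]; simp

theorem norm_pow_mul_cexp_le (k : ℕ) {s : ℝ} (hs : 0 < s) {x : ℝ} (hx : 0 ≤ x) :
    ‖((x : ℝ) : ℂ) ^ k * Complex.exp (-s * x)‖ ≤ k ! / (s / 2) ^ k * Real.exp (-(s / 2) * x) := by
  rw [norm_mul, norm_cexp_neg_mul, norm_pow, Complex.norm_real, Real.norm_of_nonneg hx]
  have h := pow_mul_exp_neg_le k (b := s / 2) (by positivity) hx
  have e : Real.exp (-s * x) = Real.exp (-(s / 2) * x) * Real.exp (-(s / 2) * x) := by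
    rw [← Real.exp_add]; ring_nf
  rw [e, ← mul_assoc]
  gcongr

/-! ### Gaussian moments and their differential equation. -/

/-- The `k`-th Gaussian moment of `g` about `z`. -/
def gaussMoment (g : Cn n → ℂ) (z : Cn n) (k : ℕ) (s : ℝ) : ℂ :=
  ∫ w, g w * (((‖z - w‖ ^ 2 : ℝ) : ℂ) ^ k * Complex.exp (-s * (‖z - w‖ ^ 2 : ℝ)))

theorem integrable_gaussMoment {g : Cn n → ℂ} (hg : MemLp g 2) (z : Cn n) (k : ℕ) {s : ℝ}
    (hs : 0 < s) : Integrable (fun w => g w * (((‖z - w‖ ^ 2 : ℝ) : ℂ) ^ k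
      * Complex.exp (-s * (‖z - w‖ ^ 2 : ℝ)))) := by
  have hc : Continuous (fun w : Cn n => ((‖z - w‖ ^ 2 : ℝ) : ℂ) ^ k
      * Complex.exp (-s * (‖z - w‖ ^ 2 : ℝ))) := by fun_prop
  exact integrable_mul_of_norm_le_gaussian hg hc.aestronglyMeasurable (half_pos hs) z fun w =>
    norm_pow_mul_cexp_le k hs (by positivity)

/-- Differentiation in s brings down -|z-w|². On t > s/2 the derivative is dominated by the
integrand of order k+1 at parameter s/2. -/
theorem hasDerivAt_gaussMoment {g : Cn n → ℂ} (hg : MemLp g 2) (z : Cn n) (k : ℕ) {s : ℝ}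
    (hs : 0 < s) : HasDerivAt (gaussMoment g z k) (-gaussMoment g z (k + 1) s) s := by
  have h2 : 0 < s / 2 := half_pos hs
  have h := hasDerivAt_integral_of_dominated_loc_of_deriv_le (μ := (volume : Measure (Cn n)))
    (F := fun s w => g w * (((‖z - w‖ ^ 2 : ℝ) : ℂ) ^ k
      * Complex.exp (-(s : ℝ) * (‖z - w‖ ^ 2 : ℝ))))
    (F' := fun s w => -(g w * (((‖z - w‖ ^ 2 : ℝ) : ℂ) ^ (k + 1)
      * Complex.exp (-(s : ℝ) * (‖z - w‖ ^ 2 : ℝ))))) (x₀ := s) (s := Set.Ioi (s / 2))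
    (bound := fun w => ‖g w * (((‖z - w‖ ^ 2 : ℝ) : ℂ) ^ (k + 1)
      * Complex.exp (-(s / 2 : ℝ) * (‖z - w‖ ^ 2 : ℝ)))‖)
    (Ioi_mem_nhds (by linarith))
    (by
      filter_upwards [Ioi_mem_nhds hs] with t ht
      exact (integrable_gaussMoment hg z k ht).aestronglyMeasurable)
    (integrable_gaussMoment hg z k hs)
    (integrable_gaussMoment hg z (k + 1) hs).aestronglyMeasurable.neg
    (Filter.Eventually.of_forall fun w t ht => by
      rw [norm_neg, norm_mul, norm_mul, norm_mul, norm_mul, norm_cexp_neg_mul, norm_cexp_neg_mul]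
      rw [Set.mem_Ioi] at ht
      gcongr)
    (integrable_gaussMoment hg z (k + 1) h2).norm
    (Filter.Eventually.of_forall fun w t _ => by
      have h0 : HasDerivAt (fun x : ℝ => (x : ℂ)) 1 t := Complex.ofRealCLM.hasDerivAt
      have h1 := ((((h0.neg).mul_const ((‖z - w‖ ^ 2 : ℝ) : ℂ)).cexp).const_mul
        (((‖z - w‖ ^ 2 : ℝ) : ℂ) ^ k)).const_mul (g w)
      refine h1.congr_deriv ?_
      rw [pow_succ]
      simp only [Pi.neg_apply]
      ring)
  have h' := h.2
  rw [integral_neg] at h'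
  exact h'

/-- This is the pairing of F with p(x) = e^{-sx}, for which 4(xp'' + np') - μ²xp = ((4s² - μ²)x -
4ns)p. Since moment 1 is minus the derivative of moment 0, it is a first-order ODE in s. Cutoffs are
needed because Green's formula requires compact support. -/
theorem gaussMoment_equation {ν μ : ℝ} {lam : ℂ} {F : Cn n → ℂ}
    (hF : F ∈ smoothEigenspace n ν μ lam) (hF2 : MemLp F 2) (z : Cn n) {s : ℝ} (hs : 0 < s) :
    -2 * μ * (2 * lam + n) * gaussMoment (fun w => F w * phaseFactor ν μ z w) z 0 s
      = (4 * s ^ 2 - μ ^ 2) * gaussMoment (fun w => F w * phaseFactor ν μ z w) z 1 s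
        - 4 * n * s * gaussMoment (fun w => F w * phaseFactor ν μ z w) z 0 s := by
  obtain ⟨χ, B, hB0, hχ, hχ0, hχ1, hχB, hχB', hχlim⟩ := exists_smooth_cutoff
  set g : Cn n → ℂ := fun w => F w * phaseFactor ν μ z w with hg_def
  have hg : MemLp g 2 := memLp_mul_phaseFactor ν μ hF2 z
  set E : Cn n → ℂ := fun w => Complex.exp (-s * (‖z - w‖ ^ 2 : ℝ)) with hE
  have hEc : Continuous E := continuous_cexp_neg_mul_norm_sub_sq s z
  set X : Cn n → ℝ := fun w => ‖z - w‖ ^ 2 with hX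
  have hXc : Continuous X := by fun_prop
  have hX0 : ∀ w, 0 ≤ X w := fun w => by positivity
  have hexp : ContDiff ℝ ∞ (fun x : ℝ => Complex.exp (-s * x)) :=
    (contDiff_const.mul Complex.ofRealCLM.contDiff).cexp
  have hN : ∀ N, -2 * μ * (2 * lam + n) * ∫ w, g w * (E w * χ N (X w))
      = ∫ w, g w * (E w * ((4 * (X w * (s ^ 2 * χ N (X w) - 2 * s * deriv (χ N) (X w)
        + deriv (deriv (χ N)) (X w)) + n * (-s * χ N (X w) + deriv (χ N) (X w)))
        - μ ^ 2 * X w * χ N (X w) : ℝ) : ℂ)) := fun N => by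
    have hp : ContDiff ℝ ∞ (fun x : ℝ => Complex.exp (-s * x) * χ N x) :=
      hexp.mul (Complex.ofRealCLM.contDiff.comp (hχ N))
    have h := integral_eigenfunction_mul_radial hF z hp (R := 2 * ((N : ℝ) + 1))
      (fun x hx => by simp [hχ0 N x hx])
    have ha : ContDiff ℝ ∞ (fun x => -s * χ N x + deriv (χ N) x) :=
      (contDiff_const.mul (hχ N)).add (contDiff_deriv (hχ N))
    have hd : ∀ x, deriv (fun x => -s * χ N x + deriv (χ N) x) x
        = -s * deriv (χ N) x + deriv (deriv (χ N)) x := fun x => by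
      rw [deriv_fun_add (((hχ N).differentiable (by simp) x).const_mul _)
        ((contDiff_deriv (hχ N)).differentiable (by simp) x), deriv_const_mul_field]
    rw [deriv_exp_mul s (hχ N), deriv_exp_mul s ha] at h
    refine h.trans (integral_congr_ae (Filter.Eventually.of_forall fun w => ?_))
    simp only [hd, hE, hX, hg_def]
    push_cast
    ring
  have hI0 := integrable_gaussMoment hg z 0 hs
  have hI1 := integrable_gaussMoment hg z 1 hs
  have L1 : Filter.Tendsto (fun N => ∫ w, g w * (E w * χ N (X w))) Filter.atTop
      (nhds (∫ w, g w * E w)) := by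
    refine tendsto_integral_of_dominated_convergence (fun w => ‖g w * (((X w : ℝ) : ℂ) ^ 0 * E w)‖)
      (fun N => ?_) hI0.norm (fun N => Filter.Eventually.of_forall fun w => ?_)
      (Filter.Eventually.of_forall fun w => ?_)
    · have : Continuous (fun w => E w * (χ N (X w) : ℂ)) :=
        hEc.mul (Complex.continuous_ofReal.comp ((hχ N).continuous.comp hXc))
      exact hg.aestronglyMeasurable.mul this.aestronglyMeasurable
    · rw [pow_zero, one_mul, ← mul_assoc, norm_mul, Complex.norm_real, Real.norm_eq_abs]
      exact mul_le_of_le_one_right (norm_nonneg _) (hχ1 N _)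
    · refine tendsto_const_nhds.congr' ?_
      filter_upwards [hχlim (X w)] with N hN
      simp [hN.1]
  have L2 : Filter.Tendsto (fun N => ∫ w, g w * (E w * ((4 * (X w * (s ^ 2 * χ N (X w)
        - 2 * s * deriv (χ N) (X w)
        + deriv (deriv (χ N)) (X w)) + n * (-s * χ N (X w) + deriv (χ N) (X w)))
        - μ ^ 2 * X w * χ N (X w) : ℝ) : ℂ))) Filter.atTop
      (nhds (∫ w, g w * (E w * ((4 * (X w * s ^ 2 + n * (-s)) - μ ^ 2 * X w : ℝ) : ℂ)))) := by
    -- The bound uses |χ| ≤ 1 and |χ'|, |χ''| ≤ B; it is linear in |z-w|², hence integrable by the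
    -- moments of orders 0 and 1.
    refine tendsto_integral_of_dominated_convergence
      (fun w => (4 * (s ^ 2 + 2 * s * B + B) + μ ^ 2) * ‖g w * (((X w : ℝ) : ℂ) ^ 1 * E w)‖
        + 4 * (n * (s + B)) * ‖g w * (((X w : ℝ) : ℂ) ^ 0 * E w)‖)
      (fun N => ?_) ((hI1.norm.const_mul _).add (hI0.norm.const_mul _))
      (fun N => Filter.Eventually.of_forall fun w => ?_) (Filter.Eventually.of_forall fun w => ?_)
    · have c0 := (hχ N).continuous
      have c1 := (contDiff_deriv (hχ N)).continuous
      have c2 := (contDiff_deriv (contDiff_deriv (hχ N))).continuous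
      have : Continuous (fun w => E w * ((4 * (X w * (s ^ 2 * χ N (X w) - 2 * s * deriv (χ N) (X w)
        + deriv (deriv (χ N)) (X w)) + n * (-s * χ N (X w) + deriv (χ N) (X w)))
        - μ ^ 2 * X w * χ N (X w) : ℝ) : ℂ)) := by fun_prop
      exact hg.aestronglyMeasurable.mul this.aestronglyMeasurable
    · have b0 := hχ1 N (X w)
      have b1 := hχB N (X w)
      have b2 := hχB' N (X w)
      generalize χ N (X w) = a at *
      generalize deriv (χ N) (X w) = a' at *
      generalize deriv (deriv (χ N)) (X w) = a'' at *
      rw [pow_zero, one_mul, pow_one, mul_comm (X w : ℂ), ← mul_assoc, ← mul_assoc, norm_mul,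
        norm_mul (g w * E w), Complex.norm_real, Complex.norm_real, Real.norm_of_nonneg (hX0 w),
        Real.norm_eq_abs]
      have hx := hX0 w
      have : |4 * (X w * (s ^ 2 * a - 2 * s * a' + a'') + n * (-s * a + a')) - μ ^ 2 * X w * a|
          ≤ (4 * (s ^ 2 + 2 * s * B + B) + μ ^ 2) * X w + 4 * (n * (s + B)) := by
        have t1 : |s ^ 2 * a - 2 * s * a' + a''| ≤ s ^ 2 + 2 * s * B + B := by
          calc _ ≤ |s ^ 2 * a| + |2 * s * a'| + |a''| :=
                (abs_add_le _ _).trans (by gcongr; exact abs_sub _ _)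
            _ ≤ s ^ 2 * 1 + 2 * s * B + B := by
              rw [abs_mul, abs_mul, abs_of_nonneg (sq_nonneg s), abs_of_pos (by positivity : 0 < 2 * s)]
              gcongr
            _ = _ := by ring
        have t2 : |-s * a + a'| ≤ s + B := by
          calc _ ≤ |-s * a| + |a'| := abs_add_le _ _
            _ ≤ s * 1 + B := by
              rw [abs_mul, abs_neg, abs_of_pos hs]
              gcongr
            _ = _ := by ring
        calc _ ≤ |4 * (X w * (s ^ 2 * a - 2 * s * a' + a'') + n * (-s * a + a'))|
              + |μ ^ 2 * X w * a| := abs_sub _ _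
          _ ≤ 4 * (X w * |s ^ 2 * a - 2 * s * a' + a''| + n * |-s * a + a'|)
              + μ ^ 2 * X w * |a| := by
            rw [abs_mul, abs_mul (μ ^ 2 * X w), abs_of_nonneg (by positivity : 0 ≤ μ ^ 2 * X w)]
            refine add_le_add ?_ le_rfl
            rw [abs_of_pos (by norm_num : (0 : ℝ) < 4)]
            gcongr
            refine (abs_add_le _ _).trans ?_
            rw [abs_mul, abs_mul, abs_of_nonneg hx, Nat.abs_cast]
          _ ≤ 4 * (X w * (s ^ 2 + 2 * s * B + B) + n * (s + B)) + μ ^ 2 * X w * 1 := by gcongr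
          _ = _ := by ring
      calc _ ≤ ‖g w * E w‖ * ((4 * (s ^ 2 + 2 * s * B + B) + μ ^ 2) * X w
            + 4 * (n * (s + B))) := by gcongr
        _ = _ := by ring
    · refine tendsto_const_nhds.congr' ?_
      filter_upwards [hχlim (X w)] with N hN
      rw [hN.1, hN.2.1, hN.2.2]
      norm_num
  have hlim := tendsto_nhds_unique ((L1.const_mul (-2 * μ * (2 * lam + n) : ℂ)).congr hN) L2
  have m0 : gaussMoment g z 0 s = ∫ w, g w * E w := by simp [gaussMoment, hE]
  rw [m0, hlim, ← m0, gaussMoment, gaussMoment, ← integral_const_mul, ← integral_const_mul,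
    ← integral_sub (hI1.const_mul _) (hI0.const_mul _)]
  refine integral_congr_ae (Filter.Eventually.of_forall fun w => ?_)
  simp only [hE, hX]
  push_cast
  ring

/-! ### Solving the equation and reading off the moments at μ/2. -/

/-- Multiplying the quotient by a positive power of d forces the constant term to vanish; one factor
d is then cancelled and the argument repeated. -/
theorem tendsto_poly_div_pow {l : ℕ} {a : ℕ → ℂ} {b : ℂ}
    (h : Filter.Tendsto (fun d : ℝ => (∑ j ∈ Finset.range (l + 1), a j * (d : ℂ) ^ j) / (d : ℂ) ^ l)
      (nhdsWithin 0 (Set.Ioi 0)) (nhds b)) : (∀ j < l, a j = 0) ∧ a l = b := by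
  induction l generalizing a with
  | zero =>
    refine ⟨fun j hj => absurd hj (Nat.not_lt_zero j), ?_⟩
    simp only [zero_add, Finset.range_one, Finset.sum_singleton, pow_zero, mul_one, div_one] at h
    exact tendsto_nhds_unique tendsto_const_nhds h
  | succ l ih =>
    have hd : Filter.Tendsto (fun d : ℝ => (d : ℂ)) (nhdsWithin 0 (Set.Ioi 0)) (nhds 0) := by
      have : Filter.Tendsto (fun d : ℝ => (d : ℂ)) (nhds 0) (nhds ((0 : ℝ) : ℂ)) :=
        Complex.continuous_ofReal.tendsto 0
      simpa using this.mono_left nhdsWithin_le_nhds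
    have hne : ∀ᶠ d : ℝ in nhdsWithin 0 (Set.Ioi 0), (d : ℂ) ≠ 0 :=
      eventually_nhdsWithin_of_forall fun d hd => by exact_mod_cast (ne_of_gt hd)
    have h1 : Filter.Tendsto (fun d : ℝ => ∑ j ∈ Finset.range (l + 1 + 1), a j * (d : ℂ) ^ j)
        (nhdsWithin 0 (Set.Ioi 0)) (nhds 0) := by
      have := h.mul (hd.pow (l + 1))
      rw [zero_pow (by omega), mul_zero] at this
      refine this.congr' ?_
      filter_upwards [hne] with d hd
      field_simp
    have h2 : Filter.Tendsto (fun d : ℝ => ∑ j ∈ Finset.range (l + 1 + 1), a j * (d : ℂ) ^ j)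
        (nhdsWithin 0 (Set.Ioi 0)) (nhds (a 0)) := by
      have := tendsto_finsetSum (Finset.range (l + 1 + 1)) fun j _ => (hd.pow j).const_mul (a j)
      rw [Finset.sum_range_succ'] at this
      simpa using this
    have h0 : a 0 = 0 := tendsto_nhds_unique h2 h1
    have := ih (a := fun j => a (j + 1)) (h.congr' (by
      filter_upwards [hne] with d hd
      rw [Finset.sum_range_succ', h0, zero_mul, add_zero, pow_succ, ← div_div, div_right_comm,
        Finset.sum_div]
      congr 1
      refine Finset.sum_congr rfl fun j _ => ?_
      rw [pow_succ]
      field_simp))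
    refine ⟨fun j hj => ?_, this.2⟩
    cases j with
    | zero => exact h0
    | succ j => exact this.1 j (by omega)

/-- The logarithmic-derivative form avoids the exponent m - 1, so m = 0 needs no special treatment
later. -/
theorem hasDerivAt_ofReal_add_pow (c : ℝ) (m : ℕ) {d : ℝ} (hd : d + c ≠ 0) :
    HasDerivAt (fun d : ℝ => ((d : ℂ) + c) ^ m) (m * (d + c : ℂ) ^ m / (d + c)) d := by
  have h0 : HasDerivAt (fun x : ℝ => (x : ℂ) + c) 1 d := (Complex.ofRealCLM.hasDerivAt).add_const _
  have hd' : (d : ℂ) + c ≠ 0 := by exact_mod_cast hd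
  refine (h0.pow m).congr_deriv ?_
  cases m with
  | zero => simp
  | succ m =>
    rw [Nat.add_sub_cancel, pow_succ]
    field_simp

theorem finrank_real_Cn (n : ℕ) : Module.finrank ℝ (Cn n) = 2 * n := by
  rw [← Module.finrank_mul_finrank ℝ ℂ (Cn n), finrank_euclideanSpace_fin,
    Complex.finrank_real_complex]

/-- Gaussian averages about `z` concentrate at `z`. -/
theorem tendsto_gaussMoment {g : Cn n → ℂ} (hg : MemLp g 2) (hgc : Continuous g) (z : Cn n)
    {s : ℝ} (hs : 0 < s) :
    Filter.Tendsto (fun c : ℝ => (c : ℂ) ^ (2 * n) * gaussMoment g z 0 (s + c ^ 2)) Filter.atTop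
      (nhds (Real.pi ^ n * g z)) := by
  have hpi : (0 : ℝ) < Real.pi ^ n := by positivity
  -- The approximate identity is π⁻ⁿe^{-|x|²} dilated by c in real dimension 2n. The remaining
  -- factor e^{-s|z-w|²} stays with g, since g alone is only in L² while the product is integrable.
  have h := tendsto_integral_comp_smul_smul_of_integrable' (μ := (volume : Measure (Cn n)))
    (g := fun w => g w * (((‖z - w‖ ^ 2 : ℝ) : ℂ) ^ 0
      * Complex.exp (-s * (‖z - w‖ ^ 2 : ℝ)))) (x₀ := z)
    (show ∀ x : Cn n, 0 ≤ (Real.pi ^ n)⁻¹ * Real.exp (-1 * ‖x‖ ^ 2) from fun x => by positivity)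
    (by
      rw [integral_const_mul, GaussianFourier.integral_rexp_neg_mul_sq_norm one_pos,
        finrank_real_Cn, div_one]
      have : ((2 * n : ℕ) : ℝ) / 2 = n := by push_cast; ring
      rw [this, Real.rpow_natCast, inv_mul_cancel₀ hpi.ne'])
    (by
      have h1 := (Real.tendsto_pow_mul_exp_neg_atTop_nhds_zero n).comp
        ((Filter.tendsto_pow_atTop (two_ne_zero)).comp (tendsto_norm_cobounded_atTop (E := Cn n)))
      have h2 := h1.const_mul (Real.pi ^ n)⁻¹
      rw [mul_zero] at h2
      refine h2.congr fun x => ?_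
      simp only [Function.comp, finrank_real_Cn]
      rw [← pow_mul, neg_one_mul]
      ring)
    (integrable_gaussMoment hg z 0 hs)
    (by fun_prop)
  have h3 := h.const_mul ((Real.pi : ℂ) ^ n)
  simp only [sub_self, norm_zero, pow_zero, one_mul] at h3
  have e : g z * Complex.exp (-s * ((0 ^ 2 : ℝ) : ℂ)) = g z := by simp
  rw [e] at h3
  refine h3.congr fun c => ?_
  rw [gaussMoment, ← integral_const_mul, ← integral_const_mul]
  refine integral_congr_ae (Filter.Eventually.of_forall fun w => ?_)
  simp only [pow_zero, one_mul]
  rw [norm_smul, Complex.real_smul, finrank_real_Cn, mul_pow, Real.norm_eq_abs, sq_abs]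
  have e2 : Complex.exp (-((s + c ^ 2 : ℝ) : ℂ) * ((‖z - w‖ ^ 2 : ℝ) : ℂ))
      = Complex.exp (-s * (‖z - w‖ ^ 2 : ℝ)) * (Real.exp (-1 * (c ^ 2 * ‖z - w‖ ^ 2)) : ℝ) := by
    rw [Complex.ofReal_exp, ← Complex.exp_add]
    congr 1
    push_cast
    ring
  have hpi' : (Real.pi : ℂ) ^ n ≠ 0 := by exact_mod_cast hpi.ne'
  rw [e2]
  push_cast
  field_simp

/-- At s = μ/2 + d one has 4s² - μ² = 4d(d+μ), and partial fractions give the solution C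
d^l/(d+μ)^{l+n}; the behaviour as d → ∞ fixes C. -/
theorem gaussMoment_eigenfunction {ν μ : ℝ} (hμ : 0 < μ) {l : ℕ} {F : Cn n → ℂ}
    (hF : F ∈ smoothEigenspace n ν μ (l : ℂ)) (hF2 : MemLp F 2) (z : Cn n) {d : ℝ} (hd : 0 < d) :
    gaussMoment (fun w => F w * phaseFactor ν μ z w) z 0 (μ / 2 + d) * (d + μ) ^ (l + n)
      = Real.pi ^ n * F z * d ^ l := by
  set g : Cn n → ℂ := fun w => F w * phaseFactor ν μ z w with hg_def
  have hg : MemLp g 2 := memLp_mul_phaseFactor ν μ hF2 z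
  have hgc : Continuous g := hF.1.continuous.mul (continuous_phaseFactor_right ν μ z)
  -- `W` is the moment divided by the expected solution, hence constant on d > 0. The summand `(0 :
  -- ℝ)` lets `hasDerivAt_ofReal_add_pow` serve both powers.
  set W : ℝ → ℂ := fun d => gaussMoment g z 0 (μ / 2 + d) * ((d : ℂ) + μ) ^ (l + n)
    / ((d : ℂ) + (0 : ℝ)) ^ l with hW
  have hWd : ∀ d : ℝ, 0 < d → HasDerivAt W 0 d := fun d hd => by
    have h1 := (hasDerivAt_gaussMoment hg z 0 (s := μ / 2 + d) (by positivity)).comp_const_add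
      (μ / 2) d
    have h2 := hasDerivAt_ofReal_add_pow μ (l + n) (d := d) (by positivity)
    have h3 := hasDerivAt_ofReal_add_pow 0 l (d := d) (by simpa using hd.ne')
    have hd0 : (d : ℂ) ≠ 0 := by exact_mod_cast hd.ne'
    have hdm : (d : ℂ) + μ ≠ 0 := by exact_mod_cast (by positivity : d + μ ≠ 0)
    have hd0' : (d : ℂ) + (0 : ℝ) ≠ 0 := by simpa using hd0
    refine ((h1.mul h2).div h3 (pow_ne_zero _ hd0')).congr_deriv ?_
    have ode := gaussMoment_equation hF hF2 z (s := μ / 2 + d) (by positivity)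
    rw [← hg_def] at ode
    simp only [Complex.ofReal_zero, add_zero, Pi.mul_apply, zero_add]
    generalize gaussMoment g z 0 (μ / 2 + d) = m0 at *
    generalize gaussMoment g z 1 (μ / 2 + d) = m1 at *
    rw [div_eq_zero_iff]
    left
    field_simp
    push_cast at ode ⊢
    linear_combination ((d : ℂ) ^ l * (d + μ : ℂ) ^ (l + n) / 4) * ode
  have hconst : ∀ d e : ℝ, 0 < d → 0 < e → W d = W e := fun d e hd he =>
    isOpen_Ioi.is_const_of_deriv_eq_zero isPreconnected_Ioi
      (fun x hx => (hWd x hx).differentiableAt.differentiableWithinAt)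
      (fun x hx => (hWd x hx).deriv) hd he
  have hlim : Filter.Tendsto (fun c : ℝ => W (c ^ 2)) Filter.atTop
      (nhds (Real.pi ^ n * F z)) := by
    have h1 := tendsto_gaussMoment hg hgc z (half_pos hμ)
    -- At d = c² the factor (d+μ)^{l+n}/d^l equals c^{2n}(1 + μ/c²)^{l+n}, so only this correction
    -- tending to 1 has to be added to the concentration limit.
    have h2 : Filter.Tendsto (fun c : ℝ => ((1 + μ * ((c ^ 2)⁻¹ : ℝ) : ℂ)) ^ (l + n)) Filter.atTop
        (nhds ((1 + μ * ((0 : ℝ) : ℂ)) ^ (l + n))) := by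
      have : Filter.Tendsto (fun c : ℝ => (c ^ 2)⁻¹) Filter.atTop (nhds 0) :=
        tendsto_inv_atTop_zero.comp (Filter.tendsto_pow_atTop two_ne_zero)
      exact ((((Complex.continuous_ofReal.tendsto 0).comp this).const_mul (μ : ℂ)).const_add 1).pow _
    have h3 := h1.mul h2
    have e : g z = F z := by simp [hg_def, phaseFactor_self]
    rw [e, Complex.ofReal_zero, mul_zero, add_zero, one_pow, mul_one] at h3
    refine h3.congr' ?_
    filter_upwards [Filter.eventually_gt_atTop 0] with c hc
    have hc0 : (c : ℂ) ≠ 0 := by exact_mod_cast hc.ne'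
    have e2 : (1 + μ * ((c ^ 2)⁻¹ : ℝ) : ℂ) = ((c : ℂ) ^ 2 + μ) / (c : ℂ) ^ 2 := by
      push_cast
      field_simp
    simp only [hW]
    rw [e2, div_pow]
    push_cast
    rw [add_zero]
    field_simp
    ring
  have hWv : W d = Real.pi ^ n * F z := by
    refine tendsto_nhds_unique ?_ hlim
    refine tendsto_const_nhds.congr' ?_
    filter_upwards [Filter.eventually_gt_atTop 0] with c hc
    exact hconst d (c ^ 2) hd (by positivity)
  have hd0 : (d : ℂ) ^ l ≠ 0 := pow_ne_zero _ (by exact_mod_cast hd.ne')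
  simp only [hW, Complex.ofReal_zero, add_zero] at hWv
  rwa [div_eq_iff hd0] at hWv

/-- With x = |z-w|², the remainder of e^{-dx} is at most (dx)^{l+1}e^{dx}. The condition d ≤ s/2
leaves decay e^{-sx/2} after multiplication by e^{-sx}. -/
theorem norm_gaussMoment_sub_taylor_le {g : Cn n → ℂ} (hg : MemLp g 2) (z : Cn n) (l : ℕ) {s : ℝ}
    (hs : 0 < s) {d : ℝ} (hd : 0 < d) (hds : d ≤ s / 2) :
    ‖gaussMoment g z 0 (s + d)
        - ∑ j ∈ Finset.range (l + 1), (-1) ^ j / (j ! : ℂ) * gaussMoment g z j s * d ^ j‖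
      ≤ (∫ w, ‖g w * (((‖z - w‖ ^ 2 : ℝ) : ℂ) ^ (l + 1)
          * Complex.exp (-(s / 2 : ℝ) * (‖z - w‖ ^ 2 : ℝ)))‖) * d ^ (l + 1) := by
  have hi : ∀ j, Integrable (fun w => (-1) ^ j / (j ! : ℂ) * (g w * (((‖z - w‖ ^ 2 : ℝ) : ℂ) ^ j
      * Complex.exp (-s * (‖z - w‖ ^ 2 : ℝ)))) * (d : ℂ) ^ j) := fun j =>
    ((integrable_gaussMoment hg z j hs).const_mul _).mul_const _
  have e : gaussMoment g z 0 (s + d)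
      - ∑ j ∈ Finset.range (l + 1), (-1) ^ j / (j ! : ℂ) * gaussMoment g z j s * d ^ j
      = ∫ w, (g w * (((‖z - w‖ ^ 2 : ℝ) : ℂ) ^ 0 * Complex.exp (-(s + d : ℝ) * (‖z - w‖ ^ 2 : ℝ)))
        - ∑ j ∈ Finset.range (l + 1), (-1) ^ j / (j ! : ℂ) * (g w * (((‖z - w‖ ^ 2 : ℝ) : ℂ) ^ j
      * Complex.exp (-s * (‖z - w‖ ^ 2 : ℝ)))) * (d : ℂ) ^ j) := by
    rw [integral_sub (integrable_gaussMoment hg z 0 (by positivity))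
      (integrable_finsetSum _ fun j _ => hi j), integral_finsetSum _ fun j _ => hi j]
    simp only [integral_mul_const, integral_const_mul, gaussMoment]
  rw [e, ← integral_mul_const]
  refine norm_integral_le_of_norm_le
    ((integrable_gaussMoment hg z (l + 1) (half_pos hs)).norm.mul_const _)
    (Filter.Eventually.of_forall fun w => ?_)
  have hx : 0 ≤ ‖z - w‖ ^ 2 := by positivity
  generalize ‖z - w‖ ^ 2 = x at *
  have e1 : g w * ((x : ℂ) ^ 0 * Complex.exp (-(s + d : ℝ) * x))
      - ∑ j ∈ Finset.range (l + 1), (-1) ^ j / (j ! : ℂ) * (g w * ((x : ℂ) ^ j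
        * Complex.exp (-s * x))) * (d : ℂ) ^ j
      = g w * Complex.exp (-s * x) * (Complex.exp (-(d * x))
        - ∑ j ∈ Finset.range (l + 1), (-(d * x : ℂ)) ^ j / j !) := by
    rw [mul_sub, Finset.mul_sum]
    congr 1
    · rw [mul_assoc, ← Complex.exp_add]
      push_cast
      ring_nf
    · refine Finset.sum_congr rfl fun j _ => ?_
      rw [neg_pow (d * x : ℂ), mul_pow]
      ring
  rw [e1, norm_mul, norm_mul, norm_mul, norm_mul, norm_cexp_neg_mul, norm_cexp_neg_mul]
  have h1 := Complex.norm_exp_sub_sum_le_norm_mul_exp (-(d * x : ℂ)) (l + 1)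
  have h2 : ‖(-(d * x : ℂ))‖ = d * x := by
    rw [norm_neg, norm_mul, Complex.norm_real, Complex.norm_real, Real.norm_of_nonneg hd.le,
      Real.norm_of_nonneg hx]
  rw [h2] at h1
  rw [norm_pow, Complex.norm_real, Real.norm_of_nonneg hx]
  calc _ ≤ ‖g w‖ * Real.exp (-s * x) * ((d * x) ^ (l + 1) * Real.exp (s / 2 * x)) := by
        gcongr
        refine h1.trans ?_
        gcongr
    _ = ‖g w‖ * (x ^ (l + 1) * (Real.exp (-s * x) * Real.exp (s / 2 * x))) * d ^ (l + 1) := by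
        rw [mul_pow]; ring
    _ = _ := by
        rw [← Real.exp_add]
        ring_nf

/-- As d → 0⁺ the moment divided by d^l converges by the explicit formula, while its Taylor
polynomial has the moments at μ/2 as coefficients; `tendsto_poly_div_pow` compares the two. -/
theorem gaussMoment_eigenfunction_half {ν μ : ℝ} (hμ : 0 < μ) {l : ℕ} {F : Cn n → ℂ}
    (hF : F ∈ smoothEigenspace n ν μ (l : ℂ)) (hF2 : MemLp F 2) (z : Cn n) :
    (∀ j < l, gaussMoment (fun w => F w * phaseFactor ν μ z w) z j (μ / 2) = 0) ∧
      gaussMoment (fun w => F w * phaseFactor ν μ z w) z l (μ / 2)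
        = (-1) ^ l * (l ! : ℂ) * (Real.pi ^ n * F z / μ ^ (l + n)) := by
  set g : Cn n → ℂ := fun w => F w * phaseFactor ν μ z w with hg_def
  have hg : MemLp g 2 := memLp_mul_phaseFactor ν μ hF2 z
  have hμ0 : (μ : ℂ) ≠ 0 := by exact_mod_cast hμ.ne'
  set S : ℝ → ℂ := fun d => ∑ j ∈ Finset.range (l + 1),
    (-1) ^ j / (j ! : ℂ) * gaussMoment g z j (μ / 2) * d ^ j with hS
  set C : ℝ := ∫ w, ‖g w * (((‖z - w‖ ^ 2 : ℝ) : ℂ) ^ (l + 1)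
    * Complex.exp (-(μ / 2 / 2 : ℝ) * (‖z - w‖ ^ 2 : ℝ)))‖ with hC
  have hpos : ∀ᶠ d : ℝ in nhdsWithin 0 (Set.Ioi 0), 0 < d :=
    eventually_nhdsWithin_of_forall fun d hd => hd
  have hsmall : ∀ᶠ d : ℝ in nhdsWithin 0 (Set.Ioi 0), d ≤ μ / 2 / 2 :=
    nhdsWithin_le_nhds ((eventually_le_nhds (by positivity)))
  have hd : Filter.Tendsto (fun d : ℝ => d) (nhdsWithin 0 (Set.Ioi 0)) (nhds 0) :=
    Filter.tendsto_id.mono_left nhdsWithin_le_nhds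
  have r1 : Filter.Tendsto (fun d : ℝ => (gaussMoment g z 0 (μ / 2 + d) - S d) / (d : ℂ) ^ l)
      (nhdsWithin 0 (Set.Ioi 0)) (nhds 0) := by
    refine squeeze_zero_norm' (a := fun d => C * d) ?_ (by simpa using hd.const_mul C)
    filter_upwards [hpos, hsmall] with d hd1 hd2
    rw [norm_div, norm_pow, Complex.norm_real, Real.norm_of_nonneg hd1.le,
      div_le_iff₀ (by positivity)]
    refine (norm_gaussMoment_sub_taylor_le hg z l (half_pos hμ) hd1 hd2).trans_eq ?_
    rw [pow_succ]
    ring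
  have r2 : Filter.Tendsto (fun d : ℝ => gaussMoment g z 0 (μ / 2 + d) / (d : ℂ) ^ l)
      (nhdsWithin 0 (Set.Ioi 0)) (nhds (Real.pi ^ n * F z / μ ^ (l + n))) := by
    have hc : Filter.Tendsto (fun d : ℝ => ((d : ℂ) + μ) ^ (l + n)) (nhdsWithin 0 (Set.Ioi 0))
        (nhds (μ ^ (l + n))) := by
      have : Continuous (fun d : ℝ => ((d : ℂ) + μ) ^ (l + n)) := by fun_prop
      simpa using (this.tendsto 0).mono_left nhdsWithin_le_nhds
    refine (tendsto_const_nhds.div hc (pow_ne_zero _ hμ0)).congr' ?_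
    filter_upwards [hpos] with d hd1
    have h := gaussMoment_eigenfunction hμ hF hF2 z hd1
    have hd0 : (d : ℂ) ^ l ≠ 0 := pow_ne_zero _ (by exact_mod_cast hd1.ne')
    have hdm : ((d : ℂ) + μ) ^ (l + n) ≠ 0 :=
      pow_ne_zero _ (by exact_mod_cast (by positivity : d + μ ≠ 0))
    rw [Pi.div_apply, div_eq_div_iff hdm hd0]
    exact h.symm
  have r3 := r2.sub r1
  rw [sub_zero] at r3
  have r4 := tendsto_poly_div_pow (l := l) (a := fun j => (-1) ^ j / (j ! : ℂ)
    * gaussMoment g z j (μ / 2)) (r3.congr fun d => by rw [hS]; ring)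
  have hf : ∀ j : ℕ, (j ! : ℂ) ≠ 0 := fun j => by exact_mod_cast j.factorial_ne_zero
  refine ⟨fun j hj => ?_, ?_⟩
  · simpa [hf j] using r4.1 j hj
  · have e : ∀ a b c : ℂ, b ≠ 0 → a * b * (a / b * c) = a * a * c := fun a b c hb => by field_simp
    rw [← r4.2, e _ _ _ (hf l), ← mul_pow]
    simp

/-! ### The kernel and its reproducing property. -/

/-- The coefficients are real because their recursion is; this is what makes the kernel Hermitian
symmetric. -/
theorem conj_hypCoeff {n : ℕ} (hn : 1 ≤ n) (l k : ℕ) : conj (hypCoeff n l k) = hypCoeff n l k := by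
  induction k with
  | zero => simp [hypCoeff]
  | succ k ih =>
    have h := hypCoeff_succ hn l k
    have h' := congrArg conj h
    simp only [map_mul, map_sub, map_add, ih, map_natCast, map_one] at h'
    have h1 : (n : ℂ) + k ≠ 0 := by exact_mod_cast (by omega : n + k ≠ 0)
    have h2 : (k : ℂ) + 1 ≠ 0 := by exact_mod_cast (by omega : k + 1 ≠ 0)
    exact mul_left_cancel₀ (mul_ne_zero h2 h1) (h'.trans h.symm)

theorem conj_expPoly_hypPoly {n : ℕ} (hn : 1 ≤ n) (l : ℕ) (μ x : ℝ) :
    conj (expPoly μ (hypPoly n l) x) = expPoly μ (hypPoly n l) x := by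
  have h2 : conj (2 : ℂ) = 2 := map_ofNat _ 2
  simp [expPoly, hypPoly, Polynomial.eval_finsetSum, Polynomial.eval_monomial, ← Complex.exp_conj,
    h2, conj_hypCoeff hn]

/-- The numerator is (-l)_l = (-1)^l l!. This leading coefficient is the only one that survives in
the reproducing formula. -/
theorem hypCoeff_self (n l : ℕ) :
    hypCoeff n l l = (-1) ^ l / (n.ascFactorial l : ℂ) := by
  have hl : (l ! : ℂ) ≠ 0 := by exact_mod_cast l.factorial_ne_zero
  rw [hypCoeff, ascPochhammer_eval_neg_eq_descPochhammer, descPochhammer_eval_eq_descFactorial,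
    Nat.descFactorial_self, ascPochhammer_nat_eq_natCast_ascFactorial]
  field_simp

/-- The kernel `P_l^{ν,μ}`, with the hypergeometric factor written as a polynomial. -/
def projKernel (n : ℕ) (ν μ : ℝ) (l : ℕ) (z w : Cn n) : ℂ :=
  ((μ : ℂ) / (Real.pi : ℂ)) ^ n * (((n - 1 + l)! : ℂ) / (((n - 1)! : ℂ) * (l ! : ℂ)))
    * phaseFactor ν μ z w * expPoly μ (hypPoly n l) (‖z - w‖ ^ 2)

theorem conj_projKernel (hn : 1 ≤ n) (ν μ : ℝ) (l : ℕ) (z w : Cn n) :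
    conj (projKernel n ν μ l z w) = projKernel n ν μ l w z := by
  simp only [projKernel, map_mul, map_div₀, map_pow, Complex.conj_ofReal, map_natCast,
    conj_phaseFactor, conj_expPoly_hypPoly hn, norm_sub_sq_comm w z]

theorem continuous_projKernel (ν μ : ℝ) (l : ℕ) :
    Continuous (fun q : Cn n × Cn n => projKernel n ν μ l q.1 q.2) := by
  have h1 := (contDiff_phaseFactor (n := n) ν μ).continuous
  have h2 : Continuous (fun q : Cn n × Cn n => expPoly μ (hypPoly n l) (‖q.1 - q.2‖ ^ 2)) :=
    (contDiff_expPoly μ (hypPoly n l)).continuous.comp (by fun_prop)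
  exact (continuous_const.mul h1).mul h2

theorem exists_norm_projKernel_le (ν : ℝ) {μ : ℝ} (hμ : 0 < μ) (l : ℕ) :
    ∃ C, 0 ≤ C ∧ ∀ z w : Cn n,
      ‖projKernel n ν μ l z w‖ ≤ C * Real.exp (-(μ / 4) * ‖z - w‖ ^ 2) := by
  obtain ⟨C, hC, h⟩ := exists_norm_expPoly_le hμ (hypPoly n l)
  refine ⟨‖((μ : ℂ) / (Real.pi : ℂ)) ^ n * (((n - 1 + l)! : ℂ) / (((n - 1)! : ℂ) * (l ! : ℂ)))‖ * C,
    by positivity, fun z w => ?_⟩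
  rw [projKernel, norm_mul, norm_mul, norm_phaseFactor, mul_one, mul_assoc _ C]
  gcongr
  exact h _ (by positivity)

theorem continuous_projKernel_right (ν μ : ℝ) (l : ℕ) (z : Cn n) :
    Continuous (fun w => projKernel n ν μ l z w) :=
  Continuous.comp (g := fun q : Cn n × Cn n => projKernel n ν μ l q.1 q.2) (f := fun w => (z, w))
    (continuous_projKernel ν μ l) (continuous_const.prodMk continuous_id)

theorem integrable_projKernel_mul (ν : ℝ) {μ : ℝ} (hμ : 0 < μ) (l : ℕ) {f : Cn n → ℂ}
    (hf : MemLp f 2) (z : Cn n) : Integrable (fun w => projKernel n ν μ l z w * f w) := by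
  obtain ⟨C, -, h⟩ := exists_norm_projKernel_le (n := n) ν hμ l
  refine (integrable_mul_of_norm_le_gaussian hf
    (continuous_projKernel_right ν μ l z).aestronglyMeasurable (by positivity : 0 < μ / 4) z
    (h z)).congr (Filter.Eventually.of_forall fun w => mul_comm _ _)

/-- The kernel reproduces the square-integrable eigenfunctions. -/
theorem integral_projKernel_mul_eigenfunction (hn : 1 ≤ n) {ν μ : ℝ} (hμ : 0 < μ) {l : ℕ}
    {F : Cn n → ℂ} (hF : F ∈ smoothEigenspace n ν μ (l : ℂ)) (hF2 : MemLp F 2) (z : Cn n) :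
    ∫ w, projKernel n ν μ l z w * F w = F z := by
  obtain ⟨h0, hl⟩ := gaussMoment_eigenfunction_half hμ hF hF2 z
  have hg : MemLp (fun w => F w * phaseFactor ν μ z w) 2 := memLp_mul_phaseFactor ν μ hF2 z
  set A : ℂ := ((μ : ℂ) / (Real.pi : ℂ)) ^ n * (((n - 1 + l)! : ℂ) / (((n - 1)! : ℂ) * (l ! : ℂ)))
    with hA
  have e : ∀ w, projKernel n ν μ l z w * F w = ∑ k ∈ Finset.range (l + 1),
      A * hypCoeff n l k * μ ^ k * ((fun w => F w * phaseFactor ν μ z w) w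
        * (((‖z - w‖ ^ 2 : ℝ) : ℂ) ^ k * Complex.exp (-(μ / 2 : ℝ) * (‖z - w‖ ^ 2 : ℝ)))) := by
    intro w
    rw [projKernel, ← hA, expPoly, hypPoly, Polynomial.eval_finsetSum, Finset.mul_sum,
      Finset.mul_sum, Finset.sum_mul]
    refine Finset.sum_congr rfl fun k _ => ?_
    rw [Polynomial.eval_monomial, mul_pow]
    push_cast
    ring
  simp only [e]
  rw [integral_finsetSum _ fun k _ =>
    ((integrable_gaussMoment hg z k (half_pos hμ)).const_mul _)]
  simp only [integral_const_mul]
  change ∑ k ∈ Finset.range (l + 1), A * hypCoeff n l k * μ ^ k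
    * gaussMoment (fun w => F w * phaseFactor ν μ z w) z k (μ / 2) = F z
  -- All moments of order k < l vanish, leaving the leading term.
  rw [Finset.sum_range_succ, Finset.sum_eq_zero fun k hk => by
    rw [h0 k (Finset.mem_range.1 hk), mul_zero], zero_add, hl, hypCoeff_self, hA]
  have f1 : (l ! : ℂ) ≠ 0 := by exact_mod_cast l.factorial_ne_zero
  have f2 : ((n - 1)! : ℂ) ≠ 0 := by exact_mod_cast (n - 1).factorial_ne_zero
  -- The factorial ratio in the kernel is n(n+1)⋯(n+l-1)/l!; it cancels the denominator of the
  -- leading coefficient and the l! of the l-th moment.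
  have f4 : ((n - 1 + l)! : ℂ) = ((n - 1)! : ℂ) * (n.ascFactorial l : ℂ) := by
    rw [← Nat.cast_mul, Nat.factorial_mul_ascFactorial' n l hn]
    congr 2
    omega
  have f3 : (n.ascFactorial l : ℂ) ≠ 0 := fun h => by
    rw [h, mul_zero] at f4
    exact (n - 1 + l).factorial_ne_zero (by exact_mod_cast f4)
  have hμ0 : (μ : ℂ) ≠ 0 := by exact_mod_cast hμ.ne'
  have hpi : (Real.pi : ℂ) ≠ 0 := by exact_mod_cast Real.pi_ne_zero
  have hs : ((-1 : ℂ) ^ l) * (-1) ^ l = 1 := by rw [← mul_pow]; simp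
  rw [f4, pow_add, div_pow]
  calc _ = (((-1 : ℂ) ^ l) * (-1) ^ l) * F z := by
        generalize (-1 : ℂ) ^ l = t
        field_simp
    _ = F z := by rw [hs, one_mul]

/-! ### Smoothness of the integral operator's output. -/

/-- Functions that are integrable against every exponential weight. -/
def ExpDecay (g : Cn n → ℂ) : Prop :=
  AEStronglyMeasurable g ∧ ∀ R : ℝ, Integrable (fun w => Real.exp (R * ‖w‖) * ‖g w‖)

theorem ExpDecay.integrable_mul {g : Cn n → ℂ} (hg : ExpDecay g) {q : Cn n → ℂ}
    (hq : Continuous q) {C R : ℝ} (h : ∀ w, ‖q w‖ ≤ C * Real.exp (R * ‖w‖)) :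
    Integrable (fun w => q w * g w) := by
  refine ((hg.2 R).const_mul C).mono' (hq.aestronglyMeasurable.mul hg.1)
    (Filter.Eventually.of_forall fun w => ?_)
  rw [norm_mul, ← mul_assoc]
  gcongr
  exact h w

theorem ExpDecay.mul {g : Cn n → ℂ} (hg : ExpDecay g) {q : Cn n → ℂ}
    (hq : Continuous q) {C R : ℝ} (h : ∀ w, ‖q w‖ ≤ C * Real.exp (R * ‖w‖)) :
    ExpDecay (fun w => q w * g w) := by
  refine ⟨hq.aestronglyMeasurable.mul hg.1, fun S => ?_⟩
  have hc : Continuous (fun w : Cn n => Real.exp (S * ‖w‖)) := by fun_prop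
  refine ((hg.2 (S + R)).const_mul C).mono'
    (hc.aestronglyMeasurable.mul (hq.aestronglyMeasurable.mul hg.1).norm)
    (Filter.Eventually.of_forall fun w => ?_)
  rw [Real.norm_of_nonneg (by positivity), norm_mul]
  calc _ ≤ Real.exp (S * ‖w‖) * (C * Real.exp (R * ‖w‖) * ‖g w‖) := by gcongr; exact h w
    _ = _ := by rw [add_mul, Real.exp_add]; ring

theorem norm_le_exp_norm (w : Cn n) : ‖w‖ ≤ Real.exp (1 * ‖w‖) := by
  rw [one_mul]; linarith [Real.add_one_le_exp ‖w‖]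

theorem norm_cexp_clm_le (Λ : Cn n →L[ℝ] Cn n →L[ℝ] ℂ) (w z : Cn n) :
    ‖Complex.exp (Λ w z)‖ ≤ Real.exp (‖Λ‖ * ‖z‖ * ‖w‖) := by
  rw [Complex.norm_exp]
  gcongr
  calc _ ≤ ‖Λ w z‖ := Complex.re_le_norm _
    _ ≤ ‖Λ‖ * ‖w‖ * ‖z‖ := Λ.le_opNorm₂ w z
    _ = _ := by ring

theorem continuous_cexp_clm (Λ : Cn n →L[ℝ] Cn n →L[ℝ] ℂ) (z : Cn n) :
    Continuous (fun w => Complex.exp (Λ w z)) := by fun_prop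

/-- For y in the unit ball about z the derivative is dominated by an exponential in ‖w‖ times ‖g w‖;
the extra factor ‖w‖ costs 1 in the exponent. -/
theorem hasFDerivAt_integral_cexp (Λ : Cn n →L[ℝ] Cn n →L[ℝ] ℂ) {g : Cn n → ℂ} (hg : ExpDecay g)
    (z : Cn n) : Integrable (fun w => (Complex.exp (Λ w z) * g w) • Λ w) ∧
      HasFDerivAt (fun z => ∫ w, Complex.exp (Λ w z) * g w)
        (∫ w, (Complex.exp (Λ w z) * g w) • Λ w) z := by
  have hb : ∀ w, ∀ y ∈ Metric.ball z 1, ‖(Complex.exp (Λ w y) * g w) • Λ w‖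
      ≤ ‖Λ‖ * (Real.exp ((‖Λ‖ * (‖z‖ + 1) + 1) * ‖w‖) * ‖g w‖) := fun w y hy => by
    have hy' : ‖y‖ ≤ ‖z‖ + 1 := by
      have := norm_sub_norm_le y z
      rw [mem_ball_iff_norm] at hy
      linarith
    rw [norm_smul, norm_mul]
    calc _ ≤ Real.exp (‖Λ‖ * ‖y‖ * ‖w‖) * ‖g w‖ * (‖Λ‖ * ‖w‖) := by
          gcongr
          · exact norm_cexp_clm_le Λ w y
          · exact Λ.le_opNorm w
      _ ≤ Real.exp (‖Λ‖ * (‖z‖ + 1) * ‖w‖) * ‖g w‖ * (‖Λ‖ * Real.exp (1 * ‖w‖)) := by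
          gcongr
          exact norm_le_exp_norm w
      _ = _ := by rw [add_mul, Real.exp_add]; ring
  have hm : AEStronglyMeasurable (fun w => (Complex.exp (Λ w z) * g w) • Λ w) :=
    ((continuous_cexp_clm Λ z).aestronglyMeasurable.mul hg.1).smul
      Λ.continuous.aestronglyMeasurable
  have hbi := (hg.2 (‖Λ‖ * (‖z‖ + 1) + 1)).const_mul ‖Λ‖
  refine ⟨hbi.mono' hm (Filter.Eventually.of_forall fun w =>
    hb w z (Metric.mem_ball_self one_pos)), ?_⟩
  refine hasFDerivAt_integral_of_dominated_of_fderiv_le (𝕜 := ℝ)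
    (F := fun z w => Complex.exp (Λ w z) * g w)
    (F' := fun z w => (Complex.exp (Λ w z) * g w) • Λ w)
    (Metric.ball_mem_nhds z one_pos)
    (Filter.Eventually.of_forall fun y =>
      (continuous_cexp_clm Λ y).aestronglyMeasurable.mul hg.1)
    (hg.integrable_mul (continuous_cexp_clm Λ z) (C := 1) fun w => by
      rw [one_mul]; exact norm_cexp_clm_le Λ w z)
    hm (Filter.Eventually.of_forall fun w y hy => hb w y hy) hbi
    (Filter.Eventually.of_forall fun w y _ => ?_)
  have h := ((Λ w).hasFDerivAt (x := y)).cexp.mul_const (g w)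
  refine h.congr_fderiv ?_
  ext v
  simp
  ring

/-- A directional derivative replaces g by Λ(w, y)g, which is again in `ExpDecay`, so induction on
the order applies for all such g at once. -/
theorem contDiff_integral_cexp (Λ : Cn n →L[ℝ] Cn n →L[ℝ] ℂ) {g : Cn n → ℂ} (hg : ExpDecay g) :
    ContDiff ℝ ∞ (fun z => ∫ w, Complex.exp (Λ w z) * g w) := by
  rw [contDiff_infty]
  intro N
  induction N generalizing g with
  | zero =>
    refine contDiff_zero.2 (continuous_iff_continuousAt.2 fun z => ?_)
    exact (hasFDerivAt_integral_cexp Λ hg z).2.continuousAt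
  | succ N ih =>
    push_cast
    rw [contDiff_succ_iff_fderiv_apply]
    refine ⟨fun z => (hasFDerivAt_integral_cexp Λ hg z).2.differentiableAt, by simp, fun y => ?_⟩
    have hy : ExpDecay (fun w => Λ w y * g w) :=
      hg.mul (C := ‖Λ‖ * ‖y‖) (R := 1) (by fun_prop) fun w => by
        calc _ ≤ ‖Λ‖ * ‖w‖ * ‖y‖ := Λ.le_opNorm₂ w y
          _ ≤ ‖Λ‖ * Real.exp (1 * ‖w‖) * ‖y‖ := by gcongr; exact norm_le_exp_norm w
          _ = _ := by ring
    have e : (fun z => fderiv ℝ (fun z => ∫ w, Complex.exp (Λ w z) * g w) z y)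
        = fun z => ∫ w, Complex.exp (Λ w z) * (Λ w y * g w) := by
      funext z
      rw [(hasFDerivAt_integral_cexp Λ hg z).2.fderiv,
        ContinuousLinearMap.integral_apply (hasFDerivAt_integral_cexp Λ hg z).1]
      refine integral_congr_ae (Filter.Eventually.of_forall fun w => ?_)
      simp only [_root_.smul_apply, smul_eq_mul]
      ring
    rw [e]
    exact ih hy

theorem norm_coord_le (z : Cn n) (j : Fin n) : ‖z j‖ ≤ ‖z‖ := PiLp.norm_apply_le z j

theorem integrable_cexp_mul_pow (Λ : Cn n →L[ℝ] Cn n →L[ℝ] ℂ) {g : Cn n → ℂ} (hg : ExpDecay g)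
    (k : ℕ) (z : Cn n) :
    Integrable (fun w => Complex.exp (Λ w z) * (‖z - w‖ ^ 2 : ℝ) ^ k * g w) := by
  refine hg.integrable_mul (C := (2 * k)! * Real.exp ‖z‖) (R := ‖Λ‖ * ‖z‖ + 1)
    ((continuous_cexp_clm Λ z).mul (by fun_prop)) fun w => ?_
  rw [norm_mul, norm_pow, Complex.norm_real, Real.norm_of_nonneg (by positivity), ← pow_mul]
  have h1 : ‖z - w‖ ^ (2 * k) ≤ (2 * k)! * Real.exp (‖z‖ + ‖w‖) := by
    have h := Real.pow_div_factorial_le_exp ‖z - w‖ (norm_nonneg _) (2 * k)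
    have hk : (0 : ℝ) < (2 * k)! := by exact_mod_cast (2 * k).factorial_pos
    rw [div_le_iff₀ hk] at h
    refine h.trans ?_
    rw [mul_comm]
    gcongr
    exact norm_sub_le z w
  calc _ ≤ Real.exp (‖Λ‖ * ‖z‖ * ‖w‖) * ((2 * k)! * Real.exp (‖z‖ + ‖w‖)) := by
        gcongr
        exact norm_cexp_clm_le Λ w z
    _ = _ := by rw [Real.exp_add, add_mul, Real.exp_add, one_mul]; ring

theorem norm_sub_sq_expand (z w : Cn n) : ((‖z - w‖ ^ 2 : ℝ) : ℂ)
    = (‖z‖ : ℂ) ^ 2 + (‖w‖ : ℂ) ^ 2 - ∑ j, z j * conj (w j) - ∑ j, conj (z j) * w j := by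
  rw [Complex.ofReal_pow, norm_sq_eq_sum, norm_sq_eq_sum, norm_sq_eq_sum,
    ← Finset.sum_add_distrib, ← Finset.sum_sub_distrib, ← Finset.sum_sub_distrib]
  refine Finset.sum_congr rfl fun j _ => ?_
  simp only [PiLp.sub_apply, map_sub]
  ring

theorem contDiff_norm_sq_complex : ContDiff ℝ ∞ (fun z : Cn n => (‖z‖ : ℂ) ^ 2) := by
  simp only [norm_sq_eq_sum]
  exact ContDiff.sum fun j _ => (contDiff_coord j).mul (contDiff_conj_coord j)

/-- One factor |z-w|² is expanded: its z-parts leave the integral as smooth functions and its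
w-parts are absorbed into g without leaving `ExpDecay`. -/
theorem contDiff_integral_cexp_mul_pow (Λ : Cn n →L[ℝ] Cn n →L[ℝ] ℂ) {g : Cn n → ℂ}
    (hg : ExpDecay g) (k : ℕ) :
    ContDiff ℝ ∞ (fun z => ∫ w, Complex.exp (Λ w z) * (‖z - w‖ ^ 2 : ℝ) ^ k * g w) := by
  induction k generalizing g with
  | zero => simpa using contDiff_integral_cexp Λ hg
  | succ k ih =>
    have hg1 : ExpDecay (fun w => (‖w‖ : ℂ) ^ 2 * g w) :=
      hg.mul (C := 1) (R := 2) (by fun_prop) fun w => by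
        rw [norm_pow, Complex.norm_real, norm_norm, one_mul]
        calc _ ≤ Real.exp (1 * ‖w‖) ^ 2 := by gcongr; exact norm_le_exp_norm w
          _ = _ := by rw [← Real.exp_nat_mul]; norm_num
    have hg2 : ∀ j, ExpDecay (fun w => conj (w j) * g w) := fun j =>
      hg.mul (C := 1) (R := 1) (contDiff_conj_coord j).continuous fun w => by
        rw [RCLike.norm_conj, one_mul]
        exact (norm_coord_le w j).trans (norm_le_exp_norm w)
    have hg3 : ∀ j, ExpDecay (fun w => w j * g w) := fun j =>
      hg.mul (C := 1) (R := 1) (contDiff_coord j).continuous fun w => by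
        rw [one_mul]
        exact (norm_coord_le w j).trans (norm_le_exp_norm w)
    have e : ∀ z, ∫ w, Complex.exp (Λ w z) * (‖z - w‖ ^ 2 : ℝ) ^ (k + 1) * g w
        = (‖z‖ : ℂ) ^ 2 * (∫ w, Complex.exp (Λ w z) * (‖z - w‖ ^ 2 : ℝ) ^ k * g w)
          + (∫ w, Complex.exp (Λ w z) * (‖z - w‖ ^ 2 : ℝ) ^ k * ((‖w‖ : ℂ) ^ 2 * g w))
          - (∑ j, z j * ∫ w, Complex.exp (Λ w z) * (‖z - w‖ ^ 2 : ℝ) ^ k * (conj (w j) * g w))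
          - ∑ j, conj (z j) * ∫ w, Complex.exp (Λ w z) * (‖z - w‖ ^ 2 : ℝ) ^ k * (w j * g w) := by
      intro z
      have i0 := (integrable_cexp_mul_pow Λ hg k z).const_mul ((‖z‖ : ℂ) ^ 2)
      have i1 := integrable_cexp_mul_pow Λ hg1 k z
      have i2 := fun j => (integrable_cexp_mul_pow Λ (hg2 j) k z).const_mul (z j)
      have i3 := fun j => (integrable_cexp_mul_pow Λ (hg3 j) k z).const_mul (conj (z j))
      have s2 := integrable_finsetSum Finset.univ fun j _ => i2 j
      have s3 := integrable_finsetSum Finset.univ fun j _ => i3 j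
      have s1 := i0.add i1
      simp only [Pi.add_def] at s1
      have s12 := s1.sub s2
      simp only [Pi.sub_def] at s12
      simp only [← integral_const_mul]
      rw [← integral_finsetSum _ fun j _ => i2 j, ← integral_finsetSum _ fun j _ => i3 j,
        ← integral_add i0 i1, ← integral_sub s1 s2, ← integral_sub s12 s3]
      refine integral_congr_ae (Filter.Eventually.of_forall fun w => ?_)
      simp only [pow_succ _ k]
      rw [norm_sub_sq_expand z w]
      have e2 : ∑ j, z j * (Complex.exp (Λ w z) * (‖z - w‖ ^ 2 : ℝ) ^ k * (conj (w j) * g w))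
          = Complex.exp (Λ w z) * (‖z - w‖ ^ 2 : ℝ) ^ k * g w * ∑ j, z j * conj (w j) := by
        rw [Finset.mul_sum]
        exact Finset.sum_congr rfl fun j _ => by ring
      have e3 : ∑ j, conj (z j) * (Complex.exp (Λ w z) * (‖z - w‖ ^ 2 : ℝ) ^ k * (w j * g w))
          = Complex.exp (Λ w z) * (‖z - w‖ ^ 2 : ℝ) ^ k * g w * ∑ j, conj (z j) * w j := by
        rw [Finset.mul_sum]
        exact Finset.sum_congr rfl fun j _ => by ring
      rw [norm_sub_sq_expand z w] at e2 e3
      rw [e2, e3]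
      ring
    rw [funext e]
    exact (((contDiff_norm_sq_complex.mul (ih hg)).add (ih hg1)).sub
      (ContDiff.sum fun j _ => (contDiff_coord j).mul (ih (hg2 j)))).sub
      (ContDiff.sum fun j _ => (contDiff_conj_coord j).mul (ih (hg3 j)))

/-- Completing the square, half of the Gaussian beats e^{R‖w‖}; the other half is paired with f by
Cauchy–Schwarz. The parameter is complex to accommodate ν. -/
theorem expDecay_gaussian_mul {f : Cn n → ℂ} (hf : MemLp f 2) {b : ℂ} (hb : 0 < b.re) :
    ExpDecay (fun w => Complex.exp (-b * (‖w‖ : ℂ) ^ 2) * f w) := by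
  have hc : Continuous (fun w : Cn n => Complex.exp (-b * (‖w‖ : ℂ) ^ 2)) := by fun_prop
  refine ⟨hc.aestronglyMeasurable.mul hf.1, fun R => ?_⟩
  have hcR : Continuous (fun w : Cn n => Real.exp (R * ‖w‖)) := by fun_prop
  have hi := (integrable_mul_gaussian_sub hf (half_pos hb) (0 : Cn n)).const_mul
    (Real.exp (R ^ 2 / (2 * b.re)))
  refine hi.mono' (hcR.aestronglyMeasurable.mul (hc.aestronglyMeasurable.mul hf.1).norm)
    (Filter.Eventually.of_forall fun w => ?_)
  have e : ‖Complex.exp (-b * (‖w‖ : ℂ) ^ 2)‖ = Real.exp (-b.re * ‖w‖ ^ 2) := by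
    rw [Complex.norm_exp, ← Complex.ofReal_pow, Complex.re_mul_ofReal, Complex.neg_re]
  rw [Real.norm_of_nonneg (by positivity), norm_mul, e, zero_sub, norm_neg]
  have h : Real.exp (R * ‖w‖) * Real.exp (-b.re * ‖w‖ ^ 2)
      ≤ Real.exp (R ^ 2 / (2 * b.re)) * Real.exp (-(b.re / 2) * ‖w‖ ^ 2) := by
    rw [← Real.exp_add, ← Real.exp_add]
    refine Real.exp_le_exp.2 ?_
    have h1 : R * ‖w‖ ≤ R ^ 2 / (2 * b.re) + b.re / 2 * ‖w‖ ^ 2 := by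
      rw [div_add' _ _ _ (by positivity), le_div_iff₀ (by positivity)]
      nlinarith [sq_nonneg (R - b.re * ‖w‖)]
    linarith
  calc _ = Real.exp (R * ‖w‖) * Real.exp (-b.re * ‖w‖ ^ 2) * ‖f w‖ := by ring
    _ ≤ Real.exp (R ^ 2 / (2 * b.re)) * Real.exp (-(b.re / 2) * ‖w‖ ^ 2) * ‖f w‖ := by gcongr
    _ = _ := by ring

/-- The form `(w, z) ↦ μ ⟨z, w⟩` as a real bilinear map. -/
def hermL (n : ℕ) (μ : ℝ) : Cn n →L[ℝ] Cn n →L[ℝ] ℂ :=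
  (μ : ℂ) • ∑ j, (conjCoordL j).smulRight (coordL j)

theorem hermL_apply (μ : ℝ) (w z : Cn n) : hermL n μ w z = μ * ∑ j, z j * conj (w j) := by
  simp [hermL, mul_comm]

/-- The integral operator with kernel `P_l^{ν,μ}`. -/
def projOp (n : ℕ) (ν μ : ℝ) (l : ℕ) (f : Cn n → ℂ) (z : Cn n) : ℂ :=
  ∫ w, projKernel n ν μ l z w * f w

/-- The phase times e^{-μ|z-w|²/2} splits as e^{-(μ+iν)|z|²/2} e^{μ⟨z,w⟩} e^{-(μ-iν)|w|²/2}, so the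
operator is a smooth factor times Laplace-type transforms of a rapidly decaying function. -/
theorem contDiff_projOp (ν : ℝ) {μ : ℝ} (hμ : 0 < μ) (l : ℕ) {f : Cn n → ℂ} (hf : MemLp f 2) :
    ContDiff ℝ ∞ (projOp n ν μ l f) := by
  set A : ℂ := ((μ : ℂ) / (Real.pi : ℂ)) ^ n * (((n - 1 + l)! : ℂ) / (((n - 1)! : ℂ) * (l ! : ℂ)))
    with hA
  set b : ℂ := ((μ : ℂ) - Complex.I * ν) / 2 with hb
  have hbre : 0 < b.re := by simpa [hb] using hμ
  have hg := expDecay_gaussian_mul hf hbre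
  set g : Cn n → ℂ := fun w => Complex.exp (-b * (‖w‖ : ℂ) ^ 2) * f w with hg_def
  have e : ∀ z, projOp n ν μ l f z = Complex.exp (-((μ + Complex.I * ν) / 2) * (‖z‖ : ℂ) ^ 2)
      * ∑ k ∈ Finset.range (l + 1), A * hypCoeff n l k * μ ^ k
        * ∫ w, Complex.exp (hermL n μ w z) * (‖z - w‖ ^ 2 : ℝ) ^ k * g w := fun z => by
    simp only [← integral_const_mul]
    rw [← integral_finsetSum _ fun k _ =>
      (integrable_cexp_mul_pow (hermL n μ) hg k z).const_mul _, ← integral_const_mul]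
    refine integral_congr_ae (Filter.Eventually.of_forall fun w => ?_)
    have ephase : phaseFactor ν μ z w * Complex.exp (-(μ / 2) * (‖z - w‖ ^ 2 : ℝ))
        = Complex.exp (-((μ + Complex.I * ν) / 2) * (‖z‖ : ℂ) ^ 2)
          * (Complex.exp (hermL n μ w z) * Complex.exp (-b * (‖w‖ : ℂ) ^ 2)) := by
      rw [phaseFactor, ← Complex.exp_add, ← Complex.exp_add, ← Complex.exp_add,
        norm_sub_sq_expand z w, hermL_apply, hb, herm]
      simp only [map_sum, map_mul, Complex.conj_conj]
      congr 1
      ring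
    simp only [projKernel, ← hA, expPoly, hypPoly, Polynomial.eval_finsetSum,
      Polynomial.eval_monomial, hg_def]
    calc _ = (phaseFactor ν μ z w * Complex.exp (-(μ / 2) * (‖z - w‖ ^ 2 : ℝ))) * (A
          * (∑ k ∈ Finset.range (l + 1), hypCoeff n l k * (μ * (‖z - w‖ ^ 2 : ℝ)) ^ k) * f w) := by
          ring
      _ = _ := by
        rw [ephase, Finset.mul_sum, Finset.mul_sum, Finset.sum_mul, Finset.mul_sum]
        refine Finset.sum_congr rfl fun k _ => ?_
        rw [mul_pow]
        ring
  rw [funext e]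
  refine (contDiff_const.mul contDiff_norm_sq_complex).cexp.mul (ContDiff.sum fun k _ => ?_)
  exact contDiff_const.mul (contDiff_integral_cexp_mul_pow _ hg k)

/-! ### The operator maps L² into the eigenspace. -/

theorem contDiff_projKernel_left (ν μ : ℝ) (l : ℕ) (w : Cn n) :
    ContDiff ℝ ∞ (fun z => projKernel n ν μ l z w) :=
  (contDiff_const.mul (contDiff_phaseFactor_left ν μ w)).mul
    ((contDiff_expPoly μ _).comp (contDiff_norm_sub_sq w))

theorem twistedLaplacian_projKernel (hn : 1 ≤ n) (ν μ : ℝ) (l : ℕ) (z w : Cn n) :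
    twistedLaplacian ν μ (fun z => projKernel n ν μ l z w) z
      = -2 * μ * (2 * l + n) * projKernel n ν μ l z w := by
  set A : ℂ := ((μ : ℂ) / (Real.pi : ℂ)) ^ n * (((n - 1 + l)! : ℂ) / (((n - 1)! : ℂ) * (l ! : ℂ)))
    with hA
  have e : (fun z => projKernel n ν μ l z w)
      = A • fun z => phaseFactor ν μ z w * expPoly μ (hypPoly n l) (‖z - w‖ ^ 2) := by
    funext z
    rw [projKernel, ← hA, Pi.smul_apply, smul_eq_mul, mul_assoc]
  have hc : ContDiff ℝ ∞
      (fun z => phaseFactor ν μ z w * expPoly μ (hypPoly n l) (‖z - w‖ ^ 2)) :=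
    (contDiff_phaseFactor_left ν μ w).mul ((contDiff_expPoly μ _).comp (contDiff_norm_sub_sq w))
  rw [e, twistedLaplacian_smul ν μ A hc, Pi.smul_apply,
    twistedLaplacian_phaseFactor_mul_radial ν μ (contDiff_expPoly μ _),
    expPoly_hypPoly_radial_equation hn, projKernel, ← hA, smul_eq_mul]
  ring

/-- The Gaussian weight dominating the kernel. -/
def gaussWeight (b : ℝ) (x : Cn n) : ℝ := Real.exp (-b * ‖x‖ ^ 2)

theorem gaussWeight_neg_sub (b : ℝ) (z w : Cn n) : gaussWeight b (z - w) = gaussWeight b (w - z) := by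
  rw [gaussWeight, gaussWeight, norm_sub_rev]

theorem integrable_gaussWeight_mul {b : ℝ} (hb : 0 < b) {f : Cn n → ℂ} (hf : MemLp f 2) :
    Integrable (fun q : Cn n × Cn n => ‖f q.2‖ ^ 2 * gaussWeight b (q.1 - q.2))
      (volume.prod volume) :=
  Integrable.convolution_integrand (ContinuousLinearMap.mul ℝ ℝ)
    ((memLp_two_iff_integrable_sq_norm hf.1).1 hf) (integrable_gaussian hb)

/-- The bound |h||f| ≤ |f|² + |h|² reduces to two convolution integrands of L¹ functions; this
licenses every use of Fubini below. -/
theorem integrable_mul_projKernel_mul (ν : ℝ) {μ : ℝ} (hμ : 0 < μ) (l : ℕ) {h f : Cn n → ℂ}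
    (hh : MemLp h 2) (hf : MemLp f 2) :
    Integrable (fun q : Cn n × Cn n => h q.1 * (projKernel n ν μ l q.1 q.2 * f q.2))
      (volume.prod volume) := by
  obtain ⟨C, hC, hK⟩ := exists_norm_projKernel_le (n := n) ν hμ l
  have hb : 0 < μ / 4 := by positivity
  have i1 := (integrable_gaussWeight_mul hb hf).const_mul C
  have i2 := ((integrable_gaussWeight_mul hb hh).swap).const_mul C
  refine (i1.add i2).mono' (hh.1.comp_fst.mul
    ((continuous_projKernel ν μ l).aestronglyMeasurable.mul hf.1.comp_snd))
    (Filter.Eventually.of_forall fun q => ?_)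
  have hq : ‖h q.1‖ * ‖f q.2‖ ≤ ‖f q.2‖ ^ 2 + ‖h q.1‖ ^ 2 := by
    nlinarith [sq_nonneg (‖h q.1‖ - ‖f q.2‖), sq_nonneg (‖h q.1‖ + ‖f q.2‖)]
  simp only [Pi.add_apply, Function.comp, Prod.swap]
  rw [gaussWeight_neg_sub _ q.2 q.1, norm_mul, norm_mul]
  calc _ ≤ ‖h q.1‖ * (C * gaussWeight (μ / 4) (q.1 - q.2) * ‖f q.2‖) := by
        gcongr
        exact hK _ _
    _ = C * gaussWeight (μ / 4) (q.1 - q.2) * (‖h q.1‖ * ‖f q.2‖) := by ring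
    _ ≤ C * gaussWeight (μ / 4) (q.1 - q.2) * (‖f q.2‖ ^ 2 + ‖h q.1‖ ^ 2) := by
        have : 0 ≤ gaussWeight (μ / 4) (q.1 - q.2) := (Real.exp_pos _).le
        gcongr
    _ = _ := by ring

theorem integral_mul_projOp (ν : ℝ) {μ : ℝ} (hμ : 0 < μ) (l : ℕ) {h f : Cn n → ℂ}
    (hh : MemLp h 2) (hf : MemLp f 2) :
    ∫ z, h z * projOp n ν μ l f z = ∫ w, f w * ∫ z, projKernel n ν μ l z w * h z := by
  simp only [projOp, ← integral_const_mul]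
  rw [integral_integral_swap (f := fun z w => h z * (projKernel n ν μ l z w * f w))
    (integrable_mul_projKernel_mul ν hμ l hh hf)]
  refine integral_congr_ae (Filter.Eventually.of_forall fun w => ?_)
  refine integral_congr_ae (Filter.Eventually.of_forall fun z => ?_)
  simp only
  ring

/-- Schur-type estimate: Cauchy–Schwarz with the Gaussian weight bounds |Pf|² pointwise almost
everywhere by a multiple of |f|² convolved with the weight, which is integrable. -/
theorem memLp_projOp (ν : ℝ) {μ : ℝ} (hμ : 0 < μ) (l : ℕ) {f : Cn n → ℂ} (hf : MemLp f 2) :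
    MemLp (projOp n ν μ l f) 2 := by
  obtain ⟨C, hC, hK⟩ := exists_norm_projKernel_le (n := n) ν hμ l
  have hb : 0 < μ / 4 := by positivity
  have hm : AEStronglyMeasurable (projOp n ν μ l f) :=
    (contDiff_projOp ν hμ l hf).continuous.aestronglyMeasurable
  rw [memLp_two_iff_integrable_sq_norm hm]
  have hw0 : ∀ x : Cn n, 0 ≤ gaussWeight (μ / 4) x := fun x => (Real.exp_pos _).le
  -- Adding 1 to the mass of the weight makes `S` visibly positive, so division by it is safe.
  set S : ℝ := (∫ x : Cn n, gaussWeight (μ / 4) x) + 1 with hS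
  have hS0 : 0 < S := by
    have : 0 ≤ ∫ x : Cn n, gaussWeight (μ / 4) x := integral_nonneg hw0
    linarith
  have hQ := (integrable_gaussWeight_mul hb hf).integral_prod_left
  refine (hQ.const_mul (C ^ 2 * S)).mono' (hm.norm.pow 2) ?_
  filter_upwards [(integrable_gaussWeight_mul hb hf).prod_right_ae] with z hz
  rw [Real.norm_of_nonneg (by positivity)]
  set Q : ℝ := ∫ w, ‖f w‖ ^ 2 * gaussWeight (μ / 4) (z - w) with hQdef
  set y : ℝ := ∫ w, ‖f w‖ * gaussWeight (μ / 4) (z - w) with hy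
  have hyi : Integrable (fun w => ‖f w‖ * gaussWeight (μ / 4) (z - w)) :=
    integrable_mul_gaussian_sub hf hb z
  have hwi : Integrable (fun w => gaussWeight (μ / 4) (z - w)) := integrable_gaussian_sub hb z
  have hwS : ∫ w, gaussWeight (μ / 4) (z - w) = S - 1 := by
    rw [integral_sub_left_eq_self (fun x => gaussWeight (μ / 4) x) volume z, hS]
    ring
  -- Cauchy–Schwarz by hand: integrate the nonnegative function (y/S - |f|)² against the weight.
  have h1 : 2 * (y / S) * y ≤ (y / S) ^ 2 * (S - 1) + Q := by
    rw [← hwS, hy, ← integral_const_mul, ← integral_const_mul, ← hy,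
      ← integral_add (hwi.const_mul _) hz]
    refine integral_mono (hyi.const_mul _) ((hwi.const_mul _).add hz) fun w => ?_
    simp only
    nlinarith [hw0 (z - w), mul_nonneg (hw0 (z - w)) (sq_nonneg (y / S - ‖f w‖))]
  have h2 : y ^ 2 ≤ S * Q := by
    have e1 : 2 * (y / S) * y = 2 * (y ^ 2 / S) := by ring
    have e2 : (y / S) ^ 2 * (S - 1) = y ^ 2 / S - (y / S) ^ 2 := by
      field_simp
    have h3 : y ^ 2 / S ≤ Q := by nlinarith [sq_nonneg (y / S)]
    rwa [div_le_iff₀ hS0, mul_comm] at h3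
  have h4 : ‖projOp n ν μ l f z‖ ≤ C * y := by
    rw [hy, ← integral_const_mul]
    refine norm_integral_le_of_norm_le (hyi.const_mul C) (Filter.Eventually.of_forall fun w => ?_)
    rw [norm_mul]
    calc _ ≤ C * gaussWeight (μ / 4) (z - w) * ‖f w‖ := by gcongr; exact hK z w
      _ = _ := by ring
  calc _ ≤ (C * y) ^ 2 := by gcongr
    _ = C ^ 2 * y ^ 2 := by ring
    _ ≤ C ^ 2 * (S * Q) := by gcongr
    _ = _ := by ring

theorem integral_projKernel_mul_twistedLaplacian (hn : 1 ≤ n) (ν μ : ℝ) (l : ℕ) {u : Cn n → ℂ}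
    (hu : ContDiff ℝ ∞ u) (hc : HasCompactSupport u) (w : Cn n) :
    ∫ z, projKernel n ν μ l z w * twistedLaplacian (-ν) (-μ) u z
      = -2 * μ * (2 * l + n) * ∫ z, projKernel n ν μ l z w * u z := by
  rw [← integral_twistedLaplacian_mul ν μ (contDiff_projKernel_left ν μ l w) hu hc,
    ← integral_const_mul]
  simp only [twistedLaplacian_projKernel hn, mul_assoc]

/-- The equation is proved weakly: the transposed operator falls on the test function, Fubini brings
it against the kernel in z, and Green's formula returns it to the kernel. No differentiation under
the integral is needed, and continuity upgrades almost everywhere to everywhere. -/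
theorem projOp_mem_smoothEigenspace (hn : 1 ≤ n) (ν : ℝ) {μ : ℝ} (hμ : 0 < μ) (l : ℕ)
    {f : Cn n → ℂ} (hf : MemLp f 2) : projOp n ν μ l f ∈ smoothEigenspace n ν μ (l : ℂ) := by
  have hP := contDiff_projOp ν hμ l hf
  have hc1 : Continuous (twistedLaplacian ν μ (projOp n ν μ l f)) :=
    (contDiff_twistedLaplacian ν μ hP).continuous
  have hc2 : Continuous (fun z => -2 * μ * (2 * l + n) * projOp n ν μ l f z) :=
    continuous_const.mul hP.continuous
  refine ⟨hP, fun z => ?_⟩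
  have hae : twistedLaplacian ν μ (projOp n ν μ l f)
      =ᵐ[volume] fun z => -2 * μ * (2 * l + n) * projOp n ν μ l f z := by
    refine ae_eq_of_integral_contDiff_smul_eq hc1.locallyIntegrable hc2.locallyIntegrable
      fun u hu hcu => ?_
    have huC : ContDiff ℝ ∞ (fun z => (u z : ℂ)) := Complex.ofRealCLM.contDiff.comp hu
    have hcC : HasCompactSupport (fun z => (u z : ℂ)) :=
      hcu.comp_left (g := Complex.ofReal) Complex.ofReal_zero
    have huL : MemLp (fun z => (u z : ℂ)) 2 := huC.continuous.memLp_of_hasCompactSupport hcC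
    have hΔL : MemLp (twistedLaplacian (-ν) (-μ) (fun z => (u z : ℂ))) 2 :=
      (contDiff_twistedLaplacian _ _ huC).continuous.memLp_of_hasCompactSupport
        (hasCompactSupport_twistedLaplacian _ _ hcC)
    simp only [Complex.real_smul]
    calc _ = ∫ z, twistedLaplacian ν μ (projOp n ν μ l f) z * (u z : ℂ) := by
          simp only [mul_comm]
      _ = ∫ z, twistedLaplacian (-ν) (-μ) (fun z => (u z : ℂ)) z * projOp n ν μ l f z := by
          rw [integral_twistedLaplacian_mul ν μ hP huC hcC]
          simp only [mul_comm]
      _ = -2 * μ * (2 * l + n) * ∫ z, (u z : ℂ) * projOp n ν μ l f z := by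
          rw [integral_mul_projOp ν hμ l hΔL hf, integral_mul_projOp ν hμ l huL hf,
            ← integral_const_mul]
          refine integral_congr_ae (Filter.Eventually.of_forall fun w => ?_)
          simp only [integral_projKernel_mul_twistedLaplacian hn ν μ l huC hcC]
          ring
      _ = _ := by
          rw [← integral_const_mul]
          refine integral_congr_ae (Filter.Eventually.of_forall fun w => ?_)
          simp only
          ring
  exact congrFun (Continuous.ae_eq_iff_eq volume hc1 hc2 |>.1 hae) z

theorem projOp_congr_ae (ν μ : ℝ) (l : ℕ) {f g : Cn n → ℂ} (h : f =ᵐ[volume] g) :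
    projOp n ν μ l f = projOp n ν μ l g := by
  funext z
  refine integral_congr_ae ?_
  filter_upwards [h] with w hw
  rw [hw]

/-! ### Identification with the orthogonal projection. -/

/-- The class of `P_l f` in `L²`. -/
def projLp (ν : ℝ) {μ : ℝ} (hμ : 0 < μ) (l : ℕ) (f : L2 n) : L2 n :=
  (memLp_projOp ν hμ l (Lp.memLp f)).toLp

theorem coeFn_projLp (ν : ℝ) {μ : ℝ} (hμ : 0 < μ) (l : ℕ) (f : L2 n) :
    projLp ν hμ l f =ᵐ[volume] projOp n ν μ l f := MemLp.coeFn_toLp _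

theorem projLp_mem (hn : 1 ≤ n) (ν : ℝ) {μ : ℝ} (hμ : 0 < μ) (l : ℕ) (f : L2 n) :
    projLp ν hμ l f ∈ l2Eigenspace n ν μ (l : ℂ) :=
  ⟨_, projOp_mem_smoothEigenspace hn ν hμ l (Lp.memLp f), coeFn_projLp ν hμ l f⟩

/-- Fubini moves the kernel onto the conjugate of F; Hermitian symmetry turns that integral into the
conjugate of the reproducing formula. -/
theorem inner_projLp (hn : 1 ≤ n) (ν : ℝ) {μ : ℝ} (hμ : 0 < μ) (l : ℕ) (f : L2 n) {h : L2 n}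
    (hh : h ∈ l2Eigenspace n ν μ (l : ℂ)) : inner ℂ h (projLp ν hμ l f) = inner ℂ h f := by
  obtain ⟨F, hF, hhF⟩ := hh
  have hF2 : MemLp F 2 := (memLp_congr_ae hhF).1 (Lp.memLp h)
  have hF2c : MemLp (fun z => conj (F z)) 2 := hF2.star
  rw [L2.inner_def, L2.inner_def]
  have e1 : ∫ z, inner ℂ (h z) (projLp ν hμ l f z) = ∫ z, conj (F z) * projOp n ν μ l f z := by
    refine integral_congr_ae ?_
    filter_upwards [hhF, coeFn_projLp ν hμ l f] with z h1 h2
    rw [h1, h2, RCLike.inner_apply, mul_comm]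
  have e2 : ∫ z, inner ℂ (h z) (f z) = ∫ z, f z * conj (F z) := by
    refine integral_congr_ae ?_
    filter_upwards [hhF] with z h1
    rw [h1, RCLike.inner_apply]
  rw [e1, e2, integral_mul_projOp ν hμ l hF2c (Lp.memLp f)]
  refine integral_congr_ae (Filter.Eventually.of_forall fun w => ?_)
  simp only
  congr 1
  rw [← integral_projKernel_mul_eigenfunction hn hμ hF hF2 w, ← integral_conj]
  simp only [map_mul, conj_projKernel hn]

/-- The projection is exhibited directly: Pf lies in the eigenspace and f - Pf is orthogonal to it.
-/
theorem hasOrthogonalProjection_l2Eigenspace (hn : 1 ≤ n) (ν : ℝ) {μ : ℝ} (hμ : 0 < μ) (l : ℕ) :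
    (l2Eigenspace n ν μ (l : ℂ)).HasOrthogonalProjection where
  exists_orthogonal f := ⟨projLp ν hμ l f, projLp_mem hn ν hμ l f, by
    rw [Submodule.mem_orthogonal]
    intro h hh
    rw [inner_sub_right, inner_projLp hn ν hμ l f hh, sub_self]⟩

theorem starProjection_l2Eigenspace (hn : 1 ≤ n) (ν : ℝ) {μ : ℝ} (hμ : 0 < μ) (l : ℕ)
    [(l2Eigenspace n ν μ (l : ℂ)).HasOrthogonalProjection] (f : L2 n) :
    (l2Eigenspace n ν μ (l : ℂ)).starProjection f = projLp ν hμ l f := by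
  refine Submodule.eq_starProjection_of_mem_orthogonal (projLp_mem hn ν hμ l f) ?_
  rw [Submodule.mem_orthogonal]
  intro h hh
  rw [inner_sub_right, inner_projLp hn ν hμ l f hh, sub_self]

theorem isSchwartzKernel_projKernel (hn : 1 ≤ n) (ν : ℝ) {μ : ℝ} (hμ : 0 < μ) (l : ℕ)
    [(l2Eigenspace n ν μ (l : ℂ)).HasOrthogonalProjection] :
    IsSchwartzKernel (l2Eigenspace n ν μ (l : ℂ)).starProjection (projKernel n ν μ l) := by
  refine ⟨(continuous_projKernel ν μ l).locallyIntegrable, fun u v hu huc hv hvc => ?_⟩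
  have huL : MemLp u 2 := hu.continuous.memLp_of_hasCompactSupport huc
  have hvL : MemLp v 2 := hv.continuous.memLp_of_hasCompactSupport hvc
  rw [starProjection_l2Eigenspace hn ν hμ l]
  have e1 : ∫ z, v z * projLp ν hμ l (huL.toLp u) z = ∫ z, v z * projOp n ν μ l u z := by
    refine integral_congr_ae ?_
    filter_upwards [coeFn_projLp ν hμ l (huL.toLp u)] with z hz
    rw [hz, projOp_congr_ae ν μ l huL.coeFn_toLp]
  have e2 : ∀ q : Cn n × Cn n, projKernel n ν μ l q.1 q.2 * (v q.1 * u q.2)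
      = v q.1 * (projKernel n ν μ l q.1 q.2 * u q.2) := fun q => by ring
  simp only [e2]
  rw [e1, integral_prod _ (integrable_mul_projKernel_mul ν hμ l hvL huL)]
  simp only [projOp, integral_const_mul]

end TwistedLaplacian

end

theorem mainTheorem3 (n : ℕ) (hn : 1 ≤ n) (ν μ : ℝ) (hμ : 0 < μ) (l : ℕ)
    (K : TwistedLaplacian.Cn n → TwistedLaplacian.Cn n → ℂ)
    (hK : ∀ z w, K z w =
      ((μ : ℂ) / (Real.pi : ℂ)) ^ n
        * (((n - 1 + l)! : ℂ) / (((n - 1)! : ℂ) * (l ! : ℂ)))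
        * TwistedLaplacian.phaseFactor ν μ z w
        * Complex.exp (-(μ / 2 : ℂ) * (‖z - w‖ : ℂ) ^ 2)
        * TwistedLaplacian.confluentHypergeometric (-(l : ℂ)) (n : ℂ)
            ((μ : ℂ) * (‖z - w‖ : ℂ) ^ 2)) :
    ∃ _ : (TwistedLaplacian.l2Eigenspace n ν μ (l : ℂ)).HasOrthogonalProjection,
      TwistedLaplacian.IsSchwartzKernel
        (TwistedLaplacian.l2Eigenspace n ν μ (l : ℂ)).starProjection K ∧
      ∀ f : TwistedLaplacian.L2 n,
        (∀ z, Integrable (fun w => K z w * f w)) ∧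
        (TwistedLaplacian.l2Eigenspace n ν μ (l : ℂ)).starProjection f
          =ᵐ[volume] fun z => ∫ w, K z w * f w := by
  have hKe : K = TwistedLaplacian.projKernel n ν μ l := by
    funext z w
    rw [hK, TwistedLaplacian.projKernel, TwistedLaplacian.expPoly,
      TwistedLaplacian.confluentHypergeometric_neg_nat]
    push_cast
    ring
  subst hKe
  refine ⟨TwistedLaplacian.hasOrthogonalProjection_l2Eigenspace hn ν hμ l, ?_,
    fun f => ⟨fun z => ?_, ?_⟩⟩
  · exact @TwistedLaplacian.isSchwartzKernel_projKernel n hn ν μ hμ l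
      (TwistedLaplacian.hasOrthogonalProjection_l2Eigenspace hn ν hμ l)
  · exact TwistedLaplacian.integrable_projKernel_mul ν hμ l (Lp.memLp f) z
  · rw [@TwistedLaplacian.starProjection_l2Eigenspace n hn ν μ hμ l
      (TwistedLaplacian.hasOrthogonalProjection_l2Eigenspace hn ν hμ l)]
    exact TwistedLaplacian.coeFn_projLp ν hμ l f
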